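/- Let $H$ be a separable complex Hilbert space and let $\mathcal{CF}^{\rm sa}(H)$ be the set of all (not necessarily bounded) self-adjoint Fredholm operators in $H$, with the gap metric $\delta(T_1,T_2)=\|P_1-P_2\|$, where $P_i$ is the orthogonal projection of $H\oplus H$ onto the graph of $T_i$. For a continuous path $f:[0,1]\to\mathcal{CF}^{\rm sa}(H)$ choose a partition $0=t_0<t_1<\dots<t_n=1$ and numbers $\varepsilon_1,\dots,\varepsilon_n>0$ such that, for each $j$, the function $t\mapsto E_j(t):=1_{[-\varepsilon_j,\varepsilon_j]}(f(t))$ (spectral projection) is norm continuous and of finite rank on $[t_{j-1},t_j]$, and define the spectral flow of $f$ by $$\mathrm{SF}(f):=\sum_{j=1}^n\Bigl(\dim E_j^{\ge}(t_j)-\dim E_j^{\ge}(t_{j-1})\Bigr),$$ where $E_j^{\ge}(t)$ is the projection onto the subspace of the range of $E_j(t)$ spanned by the eigenvectors of $f(t)$ in this range with non-negative eigenvalues. Such choices exist for every continuous path $f$, and $\mathrm{SF}(f)$ does not depend on them. The spectral flow is homotopy invariant: if $f_1,f_2:[0,1]\to\mathcal{CF}^{\rm sa}(H)$ are continuous paths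 and $F:[0,1]\times[0,1]\to\mathcal{CF}^{\rm sa}(H)$ is a continuous map with $F(0,t)=f_1(t)$ and $F(1,t)=f_2(t)$ for all $t$, such that $\dim\ker F(s,0)$ and $\dim\ker F(s,1)$ are independent of $s$, then $\mathrm{SF}(f_1)=\mathrm{SF}(f_2)$. In particular, $\mathrm{SF}(f_1)=\mathrm{SF}(f_2)$ if $f_1$ and $f_2$ are homotopic with fixed endpoints. -/

import Mathlib

open Filter Topology

namespace GapSpectralFlow

/-! ### The graph of a self-adjoint operator and the orthogonal projection onto it -/

/-- The graph of `T`, as a subspace of the Hilbert space direct sum `H ⊕ H`. -/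
def hilbertGraph {H : Type*} [NormedAddCommGroup H] [InnerProductSpace ℂ H]
    (T : H →ₗ.[ℂ] H) : Submodule ℂ (WithLp 2 (H × H)) :=
  T.graph.comap (WithLp.linearEquiv 2 ℂ (H × H)).toLinearMap

theorem isClosed_hilbertGraph {H : Type*} [NormedAddCommGroup H] [InnerProductSpace ℂ H]
    [CompleteSpace H] {T : H →ₗ.[ℂ] H} (hT : IsSelfAdjoint T) :
    IsClosed (hilbertGraph T : Set (WithLp 2 (H × H))) :=
  (IsSelfAdjoint.isClosed hT).preimage (WithLp.prod_continuous_ofLp 2 H H)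

theorem hasOrthogonalProjection_hilbertGraph {H : Type*} [NormedAddCommGroup H]
    [InnerProductSpace ℂ H] [CompleteSpace H] {T : H →ₗ.[ℂ] H} (hT : IsSelfAdjoint T) :
    (hilbertGraph T).HasOrthogonalProjection :=
  haveI : CompleteSpace (hilbertGraph T) := (isClosed_hilbertGraph hT).completeSpace_coe
  inferInstance

/-- The orthogonal projection of `H ⊕ H` onto the graph of a self-adjoint operator. -/
noncomputable def graphProjection {H : Type*} [NormedAddCommGroup H] [InnerProductSpace ℂ H]
    [CompleteSpace H] (T : H →ₗ.[ℂ] H) (hT : IsSelfAdjoint T) :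
    WithLp 2 (H × H) →L[ℂ] WithLp 2 (H × H) :=
  haveI := hasOrthogonalProjection_hilbertGraph hT
  (hilbertGraph T).starProjection

theorem graphProjection_injective {H : Type*} [NormedAddCommGroup H] [InnerProductSpace ℂ H]
    [CompleteSpace H] {S T : H →ₗ.[ℂ] H} (hS : IsSelfAdjoint S) (hT : IsSelfAdjoint T)
    (h : graphProjection S hS = graphProjection T hT) : S = T := by
  have := hasOrthogonalProjection_hilbertGraph hS
  have := hasOrthogonalProjection_hilbertGraph hT
  have h1 : hilbertGraph S = hilbertGraph T := by
    have := congrArg (fun A : WithLp 2 (H × H) →L[ℂ] WithLp 2 (H × H) => A.range) h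
    simpa [graphProjection, Submodule.range_starProjection] using this
  apply LinearPMap.eq_of_eq_graph
  ext x
  have h2 := SetLike.ext_iff.mp h1 (WithLp.toLp 2 x)
  simpa [hilbertGraph] using h2

/-! ### The Cayley transform of a self-adjoint operator -/

/-- The map `x ↦ T x + z x` on the domain of `T`. -/
def addScalar {H : Type*} [NormedAddCommGroup H] [InnerProductSpace ℂ H]
    (T : H →ₗ.[ℂ] H) (z : ℂ) : T.domain →ₗ[ℂ] H :=
  T.toFun + z • T.domain.subtype

theorem inner_apply_comm {H : Type*} [NormedAddCommGroup H] [InnerProductSpace ℂ H]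
    [CompleteSpace H] {T : H →ₗ.[ℂ] H} (hT : IsSelfAdjoint T) (x y : T.domain) :
    inner ℂ (T x) (y : H) = inner ℂ (x : H) (T y) := by
  have h := LinearPMap.adjoint_isFormalAdjoint hT.dense_domain
  rw [LinearPMap.isSelfAdjoint_def.mp hT] at h
  exact h x y

theorem norm_sq_addScalar {H : Type*} [NormedAddCommGroup H] [InnerProductSpace ℂ H]
    [CompleteSpace H] {T : H →ₗ.[ℂ] H} (hT : IsSelfAdjoint T) {z : ℂ} (hz : z.re = 0)
    (x : T.domain) :
    ‖addScalar T z x‖ ^ 2 = ‖T x‖ ^ 2 + ‖z‖ ^ 2 * ‖(x : H)‖ ^ 2 := by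
  have h1 : (inner ℂ (T x) (x : H)).im = 0 := by
    have h := inner_apply_comm hT x x
    rw [← inner_conj_symm] at h
    have := congrArg Complex.im h
    simp only [Complex.conj_im] at this
    rw [← inner_conj_symm, Complex.conj_im]
    linarith
  have h2 : addScalar T z x = T x + z • (x : H) := rfl
  rw [h2, @norm_add_sq ℂ, inner_smul_right, norm_smul]
  have : (RCLike.re (z * inner ℂ (T x) (x : H)) : ℝ) = 0 := by
    simp [hz, h1]
  rw [this]; ring

theorem addScalar_injective {H : Type*} [NormedAddCommGroup H] [InnerProductSpace ℂ H]
    [CompleteSpace H] {T : H →ₗ.[ℂ] H} (hT : IsSelfAdjoint T) {z : ℂ} (hz : z.re = 0)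
    (hz0 : z ≠ 0) : Function.Injective (addScalar T z) := by
  rw [injective_iff_map_eq_zero]
  intro x hx
  have h := norm_sq_addScalar hT hz x
  rw [hx, norm_zero] at h
  have h3 : 0 < ‖z‖ ^ 2 := by positivity
  have h4 : ‖(x : H)‖ ^ 2 = 0 := by nlinarith [sq_nonneg ‖T x‖, sq_nonneg ‖(x : H)‖]
  ext
  simpa using h4

theorem addScalar_surjective {H : Type*} [NormedAddCommGroup H] [InnerProductSpace ℂ H]
    [CompleteSpace H] {T : H →ₗ.[ℂ] H} (hT : IsSelfAdjoint T) {z : ℂ} (hz : z ^ 2 = -1) :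
    Function.Surjective (addScalar T z) := by
  intro y
  have := hasOrthogonalProjection_hilbertGraph hT
  obtain ⟨p, hp, q, hq, hpq⟩ :=
    (hilbertGraph T).exists_add_mem_mem_orthogonal (WithLp.toLp 2 ((0 : H), y))
  obtain ⟨x, hx1, hx2⟩ := (LinearPMap.mem_graph_iff T).mp hp
  have hq' : ∀ u : T.domain, inner ℂ (-q.fst) (u : H) = inner ℂ q.snd (T u) := by
    intro u
    have h : (WithLp.toLp 2 ((u : H), T u) : WithLp 2 (H × H)) ∈ hilbertGraph T :=
      LinearPMap.mem_graph T u
    have h2 := (Submodule.mem_orthogonal' _ _).mp hq _ h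
    rw [WithLp.prod_inner_apply] at h2
    have h3 : inner ℂ q.fst (u : H) + inner ℂ q.snd (T u) = 0 := h2
    rw [inner_neg_left]
    linear_combination -h3
  have hdom : q.snd ∈ T.domain := by
    have := LinearPMap.mem_adjoint_domain_of_exists (T := T) q.snd ⟨_, hq'⟩
    rwa [LinearPMap.isSelfAdjoint_def.mp hT] at this
  have hval : T ⟨q.snd, hdom⟩ = -q.fst := by
    refine hT.dense_domain.eq_of_inner_left ℂ fun v hv => ?_
    rw [inner_apply_comm hT ⟨q.snd, hdom⟩ ⟨v, hv⟩]
    exact (hq' ⟨v, hv⟩).symm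
  have e1 : (0 : H) = x + q.fst := by
    have := congrArg WithLp.fst hpq
    simp only [WithLp.add_fst] at this
    rw [show (x : H) = p.fst from hx1]; exact this
  have e2 : y = T x + q.snd := by
    have := congrArg WithLp.snd hpq
    simp only [WithLp.add_snd] at this
    rw [show (T x : H) = p.snd from hx2]; exact this
  refine ⟨x + (-z) • ⟨q.snd, hdom⟩, ?_⟩
  have e3 : addScalar T z (x + (-z) • ⟨q.snd, hdom⟩)
      = T x + z • (x : H) - z • (T ⟨q.snd, hdom⟩) - (z ^ 2) • q.snd := by
    rw [map_add, map_smul]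
    change (T x + z • (x : H)) + (-z) • (T ⟨q.snd, hdom⟩ + z • q.snd) = _
    module
  rw [e3, hval, hz, e2]
  have e4 : q.fst = -(x : H) := by
    rw [eq_neg_iff_add_eq_zero, add_comm]; exact e1.symm
  rw [e4]
  module

/-- The bijection `T + i : dom T → H`. -/
noncomputable def addIEquiv {H : Type*} [NormedAddCommGroup H] [InnerProductSpace ℂ H]
    [CompleteSpace H] (T : H →ₗ.[ℂ] H) (hT : IsSelfAdjoint T) : T.domain ≃ₗ[ℂ] H :=
  LinearEquiv.ofBijective (addScalar T Complex.I)
    ⟨addScalar_injective hT Complex.I_re Complex.I_ne_zero,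
      addScalar_surjective hT Complex.I_sq⟩

/-- The Cayley transform `(T - i) (T + i)⁻¹` of a self-adjoint operator `T`, a surjective
isometry of `H`. -/
noncomputable def cayleyEquiv {H : Type*} [NormedAddCommGroup H] [InnerProductSpace ℂ H]
    [CompleteSpace H] (T : H →ₗ.[ℂ] H) (hT : IsSelfAdjoint T) : H ≃ₗᵢ[ℂ] H :=
  LinearIsometryEquiv.ofSurjective
    { toLinearMap := addScalar T (-Complex.I) ∘ₗ (addIEquiv T hT).symm.toLinearMap
      norm_map' := by
        intro y
        obtain ⟨x, rfl⟩ := (addIEquiv T hT).surjective y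
        have h1 := norm_sq_addScalar hT (z := Complex.I) Complex.I_re x
        have h2 := norm_sq_addScalar hT (z := -Complex.I) (by simp) x
        have h3 : addIEquiv T hT x = addScalar T Complex.I x := rfl
        simp only [LinearMap.comp_apply, LinearEquiv.coe_coe, LinearEquiv.symm_apply_apply]
        rw [h3, ← sq_eq_sq₀ (norm_nonneg _) (norm_nonneg _), h1, h2, norm_neg] }
    (by
      intro y
      obtain ⟨x, hx⟩ := addScalar_surjective hT (z := -Complex.I) (by simp) y
      exact ⟨addIEquiv T hT x, by simpa using hx⟩)

/-- The Cayley transform `(T - i) (T + i)⁻¹` as a bounded operator. -/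
noncomputable def cayley {H : Type*} [NormedAddCommGroup H] [InnerProductSpace ℂ H]
    [CompleteSpace H] (T : H →ₗ.[ℂ] H) (hT : IsSelfAdjoint T) : H →L[ℂ] H :=
  (cayleyEquiv T hT).toContinuousLinearEquiv.toContinuousLinearMap

theorem cayley_mem_unitary {H : Type*} [NormedAddCommGroup H] [InnerProductSpace ℂ H]
    [CompleteSpace H] (T : H →ₗ.[ℂ] H) (hT : IsSelfAdjoint T) :
    cayley T hT ∈ unitary (H →L[ℂ] H) :=
  (Unitary.linearIsometryEquiv.symm (cayleyEquiv T hT)).2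

/-! ### The spectral projection `1_{[-ε, ε]}(T)` -/

/-- For a continuous function `φ` of compact support on `ℝ`, the function `φ ∘ κ⁻¹` on the
unit circle, extended by `0` to the point `1` "at infinity"; here `κ(x) = (x - i) / (x + i)`, so
that `κ⁻¹(z) = i (1 + z) / (1 - z)`, which is real for `z ≠ 1` on the circle. -/
noncomputable def onCircle (φ : ℝ → ℝ) (z : ℂ) : ℂ :=
  if z = 1 then 0 else ((φ (Complex.I * (1 + z) / (1 - z)).re : ℝ) : ℂ)

/-- The operator `φ(T)`, for a self-adjoint operator `T` and a continuous function `φ` of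
compact support on `ℝ`: the continuous functional calculus of the Cayley transform of `T`. -/
noncomputable def funCalc {H : Type*} [NormedAddCommGroup H] [InnerProductSpace ℂ H]
    [CompleteSpace H] (T : H →ₗ.[ℂ] H) (hT : IsSelfAdjoint T) (φ : ℝ → ℝ) : H →L[ℂ] H :=
  cfc (onCircle φ) (cayley T hT)

/-- A continuous function of compact support with values in `[0, 1]` which is equal to `1`
exactly on `[-ε, ε]`. Its powers decrease pointwise to the indicator function of `[-ε, ε]`. -/
noncomputable def plateau (ε x : ℝ) : ℝ := max 0 (1 - max 0 (|x| - ε))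

theorem plateau_nonneg (ε x : ℝ) : 0 ≤ plateau ε x := le_max_left _ _

theorem plateau_le_one (ε x : ℝ) : plateau ε x ≤ 1 := by
  unfold plateau
  have : 0 ≤ max 0 (|x| - ε) := le_max_left _ _
  exact max_le zero_le_one (by linarith)

theorem continuousOn_onCircle_plateau (ε : ℝ) :
    ContinuousOn (onCircle (plateau ε)) (Metric.sphere (0 : ℂ) 1) := by
  have hc : Continuous (plateau ε) := by unfold plateau; fun_prop
  intro z₀ hz₀
  by_cases h1 : z₀ = 1
  · subst h1
    have hev : ∀ᶠ z in 𝓝[Metric.sphere (0 : ℂ) 1] (1 : ℂ), onCircle (plateau ε) z = 0 := by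
      have hb : Metric.ball (1 : ℂ) (1 / (|ε| + 2)) ∈ 𝓝 (1 : ℂ) :=
        Metric.ball_mem_nhds _ (by positivity)
      filter_upwards [mem_nhdsWithin_of_mem_nhds hb, self_mem_nhdsWithin] with z hzb hzs
      unfold onCircle
      split_ifs with hz1
      · rfl
      have hzn : ‖z‖ = 1 := by simpa using hzs
      have hne : (1 - z) ≠ 0 := sub_ne_zero.mpr (Ne.symm hz1)
      have hd : ‖1 - z‖ < 1 / (|ε| + 2) := by
        rw [norm_sub_rev]; simpa [dist_eq_norm] using hzb
      have hd0 : 0 < ‖1 - z‖ := norm_pos_iff.mpr hne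
      have hsum : ‖1 + z‖ ^ 2 + ‖1 - z‖ ^ 2 = 4 := by
        have := parallelogram_law_with_norm ℝ (1 : ℂ) z
        rw [hzn, norm_one] at this
        nlinarith
      have hsq : z.re ^ 2 + z.im ^ 2 = 1 := by
        have h := Complex.normSq_eq_norm_sq z
        rw [hzn, Complex.normSq_apply] at h
        nlinarith
      have him : (Complex.I * (1 + z) / (1 - z)).im = 0 := by
        rw [Complex.div_im]
        simp only [Complex.mul_re, Complex.mul_im, Complex.I_re, Complex.I_im, Complex.add_re,
          Complex.add_im, Complex.one_re, Complex.one_im, Complex.sub_re, Complex.sub_im]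
        rw [← sub_div]
        apply div_eq_zero_iff.mpr
        left
        nlinarith
      have hw : ‖Complex.I * (1 + z) / (1 - z)‖ = |(Complex.I * (1 + z) / (1 - z)).re| :=
        (Complex.abs_re_eq_norm.mpr him).symm
      have hw2 : |(Complex.I * (1 + z) / (1 - z)).re| = ‖1 + z‖ / ‖1 - z‖ := by
        rw [← hw, norm_div, norm_mul, Complex.norm_I, one_mul]
      have hd1 : ‖1 - z‖ * (|ε| + 2) < 1 := by
        rwa [lt_div_iff₀ (by positivity)] at hd
      have he : 0 ≤ |ε| := abs_nonneg ε
      have hd2 : ‖1 - z‖ < 1 := by nlinarith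
      have h3 : 1 ≤ ‖1 + z‖ := by
        by_contra hlt
        push Not at hlt
        nlinarith [norm_nonneg (1 + z)]
      have h4 : |ε| + 1 ≤ ‖1 + z‖ / ‖1 - z‖ := by
        rw [le_div_iff₀ hd0]; nlinarith
      have h5 : plateau ε (Complex.I * (1 + z) / (1 - z)).re = 0 := by
        unfold plateau
        rw [hw2]
        apply max_eq_left
        have := le_max_right 0 (‖1 + z‖ / ‖1 - z‖ - ε)
        linarith [le_abs_self ε]
      rw [h5, Complex.ofReal_zero]
    have h0 : onCircle (plateau ε) 1 = 0 := by simp [onCircle]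
    unfold ContinuousWithinAt
    rw [h0]
    exact tendsto_const_nhds.congr' (hev.mono fun z hz => hz.symm)
  · apply ContinuousAt.continuousWithinAt
    have hne : (1 - z₀) ≠ 0 := sub_ne_zero.mpr (Ne.symm h1)
    have hca : ContinuousAt
        (fun z : ℂ => ((plateau ε (Complex.I * (1 + z) / (1 - z)).re : ℝ) : ℂ)) z₀ := by
      have h2 : ContinuousAt (fun z : ℂ => Complex.I * (1 + z) / (1 - z)) z₀ :=
        ContinuousAt.div (by fun_prop) (by fun_prop) hne
      exact Complex.continuous_ofReal.continuousAt.comp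
        (hc.continuousAt.comp (Complex.continuous_re.continuousAt.comp h2))
    refine hca.congr ?_
    filter_upwards [isOpen_ne.mem_nhds h1] with z hz
    simp only [onCircle]
    rw [if_neg hz]

theorem funCalc_plateau_pow {H : Type*} [NormedAddCommGroup H] [InnerProductSpace ℂ H]
    [CompleteSpace H] (T : H →ₗ.[ℂ] H) (hT : IsSelfAdjoint T) (ε : ℝ) (n : ℕ) :
    funCalc T hT (fun s => plateau ε s ^ (n + 1)) = funCalc T hT (plateau ε) ^ (n + 1) := by
  have hU := cayley_mem_unitary T hT
  have hcont : ContinuousOn (onCircle (plateau ε)) (spectrum ℂ (cayley T hT)) :=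
    (continuousOn_onCircle_plateau ε).mono (spectrum.subset_circle_of_unitary hU)
  have hn : IsStarNormal (cayley T hT) := ⟨(Unitary.star_mul_self_of_mem hU).trans (Unitary.mul_star_self_of_mem hU).symm⟩
  unfold funCalc
  rw [← cfc_pow (onCircle (plateau ε)) (n + 1) (cayley T hT) hcont]
  congr 1
  funext z
  simp only [onCircle]
  split_ifs <;> simp

/-- The powers `φ(T)ⁿ`, where `0 ≤ φ ≤ 1` and `φ = 1` exactly on `[-ε, ε]`, converge strongly. -/
theorem exists_spectralProjection {H : Type*} [NormedAddCommGroup H] [InnerProductSpace ℂ H]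
    [CompleteSpace H] (T : H →ₗ.[ℂ] H) (hT : IsSelfAdjoint T) (ε : ℝ) :
    ∃ P : H →L[ℂ] H, ∀ x : H,
      Tendsto (fun n : ℕ => funCalc T hT (fun s => plateau ε s ^ (n + 1)) x) atTop
        (𝓝 (P x)) := by
  have hU := cayley_mem_unitary T hT
  have hcont : ContinuousOn (onCircle (plateau ε)) (spectrum ℂ (cayley T hT)) :=
    (continuousOn_onCircle_plateau ε).mono (spectrum.subset_circle_of_unitary hU)
  have hn : IsStarNormal (cayley T hT) := ⟨(Unitary.star_mul_self_of_mem hU).trans (Unitary.mul_star_self_of_mem hU).symm⟩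
  have hval : ∀ z : ℂ, ∃ s : ℝ, 0 ≤ s ∧ s ≤ 1 ∧ onCircle (plateau ε) z = (s : ℂ) := by
    intro z
    unfold onCircle
    split_ifs
    · exact ⟨0, le_rfl, zero_le_one, by simp⟩
    · exact ⟨_, plateau_nonneg _ _, plateau_le_one _ _, rfl⟩
  set g := onCircle (plateau ε) with hg
  set U := cayley T hT with hUdef
  set A : H →L[ℂ] H := funCalc T hT (plateau ε) with hA
  have hAg : A = cfc g U := rfl
  have hAsa : IsSelfAdjoint A := by
    rw [hAg, isSelfAdjoint_iff, ← cfc_star]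
    congr 1
    funext z
    obtain ⟨s, -, -, hs⟩ := hval z
    rw [hs]; simp
  have hpow : ∀ n : ℕ, ‖A ^ n‖ ≤ 1 := by
    intro n
    rw [hAg, ← cfc_pow g n U hcont]
    refine norm_cfc_le zero_le_one fun z _ => ?_
    obtain ⟨s, hs0, hs1, hs⟩ := hval z
    rw [hs, norm_pow, Complex.norm_real, Real.norm_of_nonneg hs0]
    exact pow_le_one₀ hs0 hs1
  have hdecay : ∀ n : ℕ, ‖A ^ n * (1 - A)‖ ≤ 1 / ((n : ℝ) + 1) := by
    intro n
    have e : A ^ n * (1 - A) = cfc (fun z => g z ^ n * (1 - g z)) U := by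
      rw [cfc_mul (fun z => g z ^ n) (fun z => 1 - g z) U (hcont.pow n)
        (continuousOn_const.sub hcont), cfc_pow g n U hcont,
        cfc_sub (fun _ => (1 : ℂ)) g U continuousOn_const hcont, cfc_const_one ℂ U, hAg]
    rw [e]
    refine norm_cfc_le (by positivity) fun z _ => ?_
    obtain ⟨s, hs0, hs1, hs⟩ := hval z
    have e2 : g z ^ n * (1 - g z) = ((s ^ n * (1 - s) : ℝ) : ℂ) := by rw [hs]; push_cast; rfl
    rw [e2, Complex.norm_real,
      Real.norm_of_nonneg (mul_nonneg (pow_nonneg hs0 n) (by linarith))]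
    rw [le_div_iff₀ (by positivity)]
    have h1 : ((n : ℝ) + 1) * s ^ n ≤ ∑ k ∈ Finset.range (n + 1), s ^ k := by
      have : ∑ k ∈ Finset.range (n + 1), s ^ n ≤ ∑ k ∈ Finset.range (n + 1), s ^ k :=
        Finset.sum_le_sum fun k hk =>
          pow_le_pow_of_le_one hs0 hs1 (Nat.lt_succ_iff.mp (Finset.mem_range.mp hk))
      simpa using this
    have h2 := mul_neg_geom_sum s (n + 1)
    have h3 : 0 ≤ s ^ (n + 1) := pow_nonneg hs0 _
    nlinarith
  let B : H →L[ℂ] H := 1 - A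
  have hBsa : ContinuousLinearMap.adjoint B = B := by
    have : IsSelfAdjoint B := (IsSelfAdjoint.one _).sub hAsa
    exact this
  let K : Submodule ℂ H := B.ker
  have : CompleteSpace K := B.isClosed_ker.completeSpace_coe
  have hfix : ∀ x ∈ K, ∀ n : ℕ, (A ^ n) x = x := by
    intro x hx n
    have hx' : x - A x = 0 := hx
    induction n with
    | zero => simp
    | succ k ih =>
      rw [pow_succ]
      change (A ^ k) (A x) = x
      rw [← sub_eq_zero.mp hx', ih]
  have hzero : ∀ y ∈ Kᗮ, Tendsto (fun n : ℕ => (A ^ n) y) atTop (𝓝 0) := by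
    intro y hy
    have hcl : y ∈ B.range.topologicalClosure := by
      have h := Submodule.orthogonal_orthogonal_eq_closure B.range
      rw [ContinuousLinearMap.orthogonal_range, hBsa] at h
      rw [← h]; exact hy
    rw [Metric.tendsto_atTop]
    intro δ hδ
    obtain ⟨w, hw, hyw⟩ := Metric.mem_closure_iff.mp hcl (δ / 2) (by linarith)
    obtain ⟨v, rfl⟩ := hw
    obtain ⟨N, hN⟩ := exists_nat_gt (‖v‖ / (δ / 2))
    refine ⟨N, fun n hn => ?_⟩
    rw [dist_zero_right]
    have h1 : ‖(A ^ n) (B v)‖ < δ / 2 := by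
      have h2 : ‖(A ^ n * (1 - A)) v‖ ≤ 1 / ((n : ℝ) + 1) * ‖v‖ :=
        (ContinuousLinearMap.le_opNorm _ _).trans
          (mul_le_mul_of_nonneg_right (hdecay n) (norm_nonneg _))
      have h3 : (N : ℝ) ≤ n := by exact_mod_cast hn
      rw [div_lt_iff₀ (by linarith)] at hN
      refine lt_of_le_of_lt h2 ?_
      rw [one_div, inv_mul_lt_iff₀ (by positivity)]
      nlinarith
    have h4 : ‖(A ^ n) (y - B v)‖ ≤ ‖y - B v‖ :=
      ((A ^ n).le_opNorm _).trans (mul_le_of_le_one_left (norm_nonneg _) (hpow n))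
    have h5 : ‖y - B v‖ < δ / 2 := by rw [← dist_eq_norm]; exact hyw
    calc ‖(A ^ n) y‖ = ‖(A ^ n) (y - B v) + (A ^ n) (B v)‖ := by rw [← map_add, sub_add_cancel]
      _ ≤ ‖(A ^ n) (y - B v)‖ + ‖(A ^ n) (B v)‖ := norm_add_le _ _
      _ < δ := by linarith
  refine ⟨K.starProjection, fun x => ?_⟩
  have hlim : Tendsto (fun n : ℕ => (A ^ n) x) atTop (𝓝 (K.starProjection x)) := by
    have hx : ∀ n : ℕ, (A ^ n) x = K.starProjection x + (A ^ n) (x - K.starProjection x) := by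
      intro n
      rw [map_sub, hfix _ (K.starProjection_apply_mem x) n]; abel
    simp_rw [hx]
    simpa using tendsto_const_nhds.add (hzero _ (K.sub_starProjection_mem_orthogonal x))
  have hsh := (tendsto_add_atTop_iff_nat 1).mpr hlim
  refine hsh.congr fun n => ?_
  rw [funCalc_plateau_pow]

/-- The spectral projection `1_{[-ε, ε]}(T)` of a self-adjoint operator `T`: the strong limit of
the operators `φₙ(T)`, where the continuous functions `φₙ` of compact support decrease pointwise
to the indicator function of `[-ε, ε]`. -/
noncomputable def spectralProjection {H : Type*} [NormedAddCommGroup H] [InnerProductSpace ℂ H]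
    [CompleteSpace H] (T : H →ₗ.[ℂ] H) (hT : IsSelfAdjoint T) (ε : ℝ) : H →L[ℂ] H :=
  (exists_spectralProjection T hT ε).choose

/-! ### Self-adjoint Fredholm operators with the gap metric -/

/-- A closed densely defined operator is Fredholm if its kernel is finite-dimensional and its range
is closed and of finite codimension. -/
structure IsFredholm {H : Type*} [NormedAddCommGroup H] [InnerProductSpace ℂ H]
    (T : H →ₗ.[ℂ] H) : Prop where
  isClosed : T.IsClosed
  dense_domain : Dense (T.domain : Set H)
  finite_ker : FiniteDimensional ℂ (LinearMap.ker T.toFun)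
  isClosed_range : IsClosed (LinearMap.range T.toFun : Set H)
  finite_coker : FiniteDimensional ℂ (H ⧸ LinearMap.range T.toFun)

/-- The space of (in general unbounded) self-adjoint Fredholm operators in `H`. -/
structure SAFredholm (H : Type*) [NormedAddCommGroup H] [InnerProductSpace ℂ H]
    [CompleteSpace H] where
  op : H →ₗ.[ℂ] H
  selfAdjoint : IsSelfAdjoint op
  fredholm : IsFredholm op

namespace SAFredholm

/-- The gap metric: the distance of `S` and `T` is `‖P_S - P_T‖`, where `P_S` and `P_T` are the
orthogonal projections of `H ⊕ H` onto the graphs of `S` and `T`. -/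
noncomputable instance instMetricSpace {H : Type*} [NormedAddCommGroup H] [InnerProductSpace ℂ H]
    [CompleteSpace H] : MetricSpace (SAFredholm H) :=
  MetricSpace.induced (fun T : SAFredholm H => graphProjection T.op T.selfAdjoint)
    (by
      rintro ⟨S, hS, hS'⟩ ⟨T, hT, hT'⟩ h
      obtain rfl := graphProjection_injective hS hT h
      rfl)
    inferInstance

theorem dist_eq {H : Type*} [NormedAddCommGroup H] [InnerProductSpace ℂ H] [CompleteSpace H]
    (S T : SAFredholm H) :
    dist S T = ‖graphProjection S.op S.selfAdjoint - graphProjection T.op T.selfAdjoint‖ :=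
  dist_eq_norm (graphProjection S.op S.selfAdjoint) (graphProjection T.op T.selfAdjoint)

/-- The dimension of the kernel of `T`. -/
noncomputable def kerDim {H : Type*} [NormedAddCommGroup H] [InnerProductSpace ℂ H]
    [CompleteSpace H] (T : SAFredholm H) : ℕ :=
  Module.finrank ℂ (LinearMap.ker T.op.toFun)

/-- The spectral projection `E = 1_{[-ε, ε]}(T)`. -/
noncomputable def proj {H : Type*} [NormedAddCommGroup H] [InnerProductSpace ℂ H]
    [CompleteSpace H] (T : SAFredholm H) (ε : ℝ) : H →L[ℂ] H :=
  spectralProjection T.op T.selfAdjoint ε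

/-- The range of `E^≥`, where `E = 1_{[-ε, ε]}(T)`: the subspace of `E(H)` spanned by those
eigenvectors of `T` in `E(H)` whose eigenvalue is non-negative. -/
def nonnegSubspace {H : Type*} [NormedAddCommGroup H] [InnerProductSpace ℂ H]
    [CompleteSpace H] (T : SAFredholm H) (ε : ℝ) : Submodule ℂ H :=
  Submodule.span ℂ {v : H | v ∈ (T.proj ε).range ∧
    ∃ (hv : v ∈ T.op.domain) (c : ℝ), 0 ≤ c ∧ T.op ⟨v, hv⟩ = (c : ℂ) • v}

/-- The dimension of `E^≥`, where `E = 1_{[-ε, ε]}(T)` is of finite rank. -/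
noncomputable def nonnegDim {H : Type*} [NormedAddCommGroup H] [InnerProductSpace ℂ H]
    [CompleteSpace H] (T : SAFredholm H) (ε : ℝ) : ℕ :=
  Module.finrank ℂ (T.nonnegSubspace ε)

end SAFredholm

/-! ### Spectral flow -/

/-- The choices made in the definition of the spectral flow of a continuous path `f`: a partition
`0 = t₀ < t₁ < ⋯ < tₙ = 1` and numbers `ε_j > 0` such that `s ↦ 1_{[-ε_j, ε_j]}(f s)` is continuous
and of finite rank on the `j`-th interval. The intervals are numbered from `0` here. -/
structure FlowPartition {H : Type*} [NormedAddCommGroup H] [InnerProductSpace ℂ H]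
    [CompleteSpace H] (f : C(unitInterval, SAFredholm H)) where
  n : ℕ
  t : Fin (n + 1) → unitInterval
  t_strictMono : StrictMono t
  t_first : t 0 = 0
  t_last : t (Fin.last n) = 1
  ε : Fin n → ℝ
  ε_pos : ∀ j, 0 < ε j
  continuousOn_proj : ∀ j,
    ContinuousOn (fun s => (f s).proj (ε j)) (Set.Icc (t j.castSucc) (t j.succ))
  finite_rank : ∀ j, ∀ s ∈ Set.Icc (t j.castSucc) (t j.succ),
    FiniteDimensional ℂ ((f s).proj (ε j)).range

/-- The sum `∑_j (dim E_j^≥(t_j) - dim E_j^≥(t_{j-1}))`. -/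
noncomputable def FlowPartition.flow {H : Type*} [NormedAddCommGroup H] [InnerProductSpace ℂ H]
    [CompleteSpace H] {f : C(unitInterval, SAFredholm H)} (P : FlowPartition f) : ℤ :=
  ∑ j : Fin P.n, (((f (P.t j.succ)).nonnegDim (P.ε j) : ℤ)
    - ((f (P.t j.castSucc)).nonnegDim (P.ε j) : ℤ))

open Classical in
/-- The spectral flow of a continuous path of self-adjoint Fredholm operators, computed from some
choice of a partition and of numbers `ε_j` as above. (The value `0` stands for the case that there
is no such choice.) -/
noncomputable def spectralFlow {H : Type*} [NormedAddCommGroup H] [InnerProductSpace ℂ H]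
    [CompleteSpace H] (f : C(unitInterval, SAFredholm H)) : ℤ :=
  if h : Nonempty (FlowPartition f) then h.some.flow else 0

end GapSpectralFlow

/-! The gap topology is read through the Cayley transform. If `(a, T a)` is the projection of `(y,
0)` onto the graph of `T`, then `(1 + T²) a = y`, which makes the Cayley transform an affine
function of the graph projection (`cayley_apply_eq`). Hence `φ(T)` is norm continuous in `T` for
every continuous `φ` of compact support (`continuous_fc`). Sharp spectral projections have no such
continuity in general. They become continuous where a gap in the spectrum allows the indicator
function to be replaced by a continuous one.

The Fredholm property provides such gaps: `0` is at most an isolated point of the spectrum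
(`exists_isolated`). If `0` is the only possible spectral point of `T` in `(-3η, 3η)`, then every
`S` near `T` has no spectrum in `η < |c| < 2η`. So `1_{[-η, η]}(S)` is continuous in `S` near `T`
and its rank stays equal to `dim ker T`.

The number `dim E^≥` itself jumps when eigenvalues cross `0`. The jump does not depend on the
window, however: for `η ≤ ε`, the difference of the values for `ε` and for `η` is the rank of
`1_{(η, ε]}(S)`, a continuous family of projections, and is therefore locally constant
(`Isolating.eventually_nonnegDim_sub`). Both halves of the theorem rest on this.

Independence of the choices: near each parameter the partial sums of any two partitions differ from
the same local quantity `nonnegDim δ` by constants. Their difference is thus locally constant on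
`[0, 1]`, and it is `0` at the start (`FlowPartition.flow_eq`).

Homotopy invariance: a Lebesgue number gives a grid with one admissible `ε` on each small rectangle.
Across one horizontal strip the change of the flow telescopes. At interior nodes two neighbouring
values of `ε` give the same contribution, and at the two ends the contribution vanishes, because a
constant kernel dimension prevents eigenvalues from leaving or reaching `0`. -/

namespace GapSpectralFlow

/-! ### The Cayley transform on the real line -/

/-- The Cayley transform `x ↦ (x - i) / (x + i)` of the real line. -/
noncomputable def kappa (c : ℝ) : ℂ := ((c : ℂ) - Complex.I) / ((c : ℂ) + Complex.I)

theorem ofReal_add_I_ne_zero (c : ℝ) : (c : ℂ) + Complex.I ≠ 0 := by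
  intro h
  have := congrArg Complex.im h
  simp at this

theorem one_sub_kappa (c : ℝ) : 1 - kappa c = 2 * Complex.I / ((c : ℂ) + Complex.I) := by
  have := ofReal_add_I_ne_zero c
  unfold kappa
  field_simp
  ring

theorem one_add_kappa (c : ℝ) : 1 + kappa c = 2 * c / ((c : ℂ) + Complex.I) := by
  have := ofReal_add_I_ne_zero c
  unfold kappa
  field_simp
  ring

theorem kappa_ne_one (c : ℝ) : kappa c ≠ 1 := by
  intro h
  have h1 := one_sub_kappa c
  rw [h, sub_self] at h1
  have h2 : 2 * Complex.I / ((c : ℂ) + Complex.I) ≠ 0 :=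
    div_ne_zero (by simp) (ofReal_add_I_ne_zero c)
  exact h2 h1.symm

theorem kappa_zero : kappa 0 = -1 := by
  unfold kappa
  simp

theorem inv_cayley_kappa (c : ℝ) : Complex.I * (1 + kappa c) / (1 - kappa c) = c := by
  rw [one_add_kappa, one_sub_kappa]
  have := ofReal_add_I_ne_zero c
  field_simp

theorem onCircle_kappa (φ : ℝ → ℝ) (c : ℝ) : onCircle φ (kappa c) = (φ c : ℂ) := by
  rw [onCircle, if_neg (kappa_ne_one c), inv_cayley_kappa, Complex.ofReal_re]

theorem onCircle_one (φ : ℝ → ℝ) : onCircle φ 1 = 0 := by simp [onCircle]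

/-- The preimage is `i (1 + z) / (1 - z)`, whose imaginary part vanishes on the unit circle. -/
theorem exists_eq_kappa {z : ℂ} (hz : ‖z‖ = 1) (h1 : z ≠ 1) : ∃ c : ℝ, z = kappa c := by
  have hsq : z.re ^ 2 + z.im ^ 2 = 1 := by
    have h := Complex.normSq_eq_norm_sq z
    rw [hz, Complex.normSq_apply] at h
    nlinarith
  have hne : 1 - z ≠ 0 := sub_ne_zero.mpr (Ne.symm h1)
  have him : (Complex.I * (1 + z) / (1 - z)).im = 0 := by
    rw [Complex.div_im]
    simp only [Complex.mul_re, Complex.mul_im, Complex.I_re, Complex.I_im, Complex.add_re,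
      Complex.add_im, Complex.one_re, Complex.one_im, Complex.sub_re, Complex.sub_im]
    rw [← sub_div]
    apply div_eq_zero_iff.mpr
    left
    nlinarith
  refine ⟨(Complex.I * (1 + z) / (1 - z)).re, ?_⟩
  have hc : (((Complex.I * (1 + z) / (1 - z)).re : ℝ) : ℂ) = Complex.I * (1 + z) / (1 - z) :=
    Complex.ext (by simp) (by rw [him]; simp)
  have h2 := ofReal_add_I_ne_zero (Complex.I * (1 + z) / (1 - z)).re
  unfold kappa
  rw [eq_div_iff h2, hc]
  field_simp
  ring

/-! ### Compactly supported functions transplanted to the circle -/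

theorem norm_onCircle_le {φ ψ : ℝ → ℝ} (h : ∀ x, |φ x| ≤ ψ x) (z : ℂ) :
    ‖onCircle φ z‖ ≤ ‖onCircle ψ z‖ := by
  unfold onCircle
  split_ifs
  · rfl
  · rw [Complex.norm_real, Complex.norm_real]
    exact (h _).trans (le_abs_self _)

theorem continuousOn_onCircle {φ : ℝ → ℝ} (hφ : Continuous φ) {R : ℝ}
    (hR : ∀ x, R ≤ |x| → φ x = 0) :
    ContinuousOn (onCircle φ) (Metric.sphere (0 : ℂ) 1) := by
  obtain ⟨C, hC⟩ : ∃ C, ∀ x ∈ Metric.closedBall (0 : ℝ) R, ‖φ x‖ ≤ C :=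
    (isCompact_closedBall 0 R).exists_bound_of_continuousOn hφ.continuousOn
  -- Only the point `1` at infinity is delicate. There `φ` is squeezed by a multiple of a plateau
  -- function, whose continuity at `1` is known.
  have hbound : ∀ x, |φ x| ≤ |C| * plateau R x := by
    intro x
    by_cases hx : R ≤ |x|
    · rw [hR x hx, abs_zero]
      exact mul_nonneg (abs_nonneg _) (plateau_nonneg _ _)
    · push Not at hx
      have : plateau R x = 1 := by
        unfold plateau
        rw [max_eq_left (by linarith : |x| - R ≤ 0)]
        simp
      rw [this, mul_one]
      exact (hC x (by simpa using hx.le)).trans (le_abs_self C)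
  intro z₀ hz₀
  by_cases h1 : z₀ = 1
  · subst h1
    have hp := continuousOn_onCircle_plateau R 1 hz₀
    unfold ContinuousWithinAt at hp ⊢
    rw [onCircle_one] at hp ⊢
    have hp2 : Tendsto (fun z => |C| * ‖onCircle (plateau R) z‖)
        (𝓝[Metric.sphere (0 : ℂ) 1] 1) (𝓝 0) := by
      simpa using hp.norm.const_mul |C|
    refine squeeze_zero_norm (fun z => ?_) hp2
    have h2 := norm_onCircle_le hbound z
    refine h2.trans (le_of_eq ?_)
    unfold onCircle
    split_ifs
    · simp
    · rw [Complex.norm_real, Complex.norm_real, norm_mul, Real.norm_eq_abs |C|, abs_abs]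
  · apply ContinuousAt.continuousWithinAt
    have hne : (1 - z₀) ≠ 0 := sub_ne_zero.mpr (Ne.symm h1)
    have hca : ContinuousAt
        (fun z : ℂ => ((φ (Complex.I * (1 + z) / (1 - z)).re : ℝ) : ℂ)) z₀ := by
      have h2 : ContinuousAt (fun z : ℂ => Complex.I * (1 + z) / (1 - z)) z₀ :=
        ContinuousAt.div (by fun_prop) (by fun_prop) hne
      exact Complex.continuous_ofReal.continuousAt.comp
        (hφ.continuousAt.comp (Complex.continuous_re.continuousAt.comp h2))
    refine hca.congr ?_
    filter_upwards [isOpen_ne.mem_nhds h1] with z hz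
    simp only [onCircle]
    rw [if_neg hz]

theorem continuous_plateau (ε : ℝ) : Continuous (plateau ε) := by unfold plateau; fun_prop

theorem plateau_eq_one_iff {ε x : ℝ} : plateau ε x = 1 ↔ |x| ≤ ε := by
  unfold plateau
  constructor
  · intro h
    by_contra hx
    push Not at hx
    rcases max_choice 0 (1 - max 0 (|x| - ε)) with h1 | h1 <;> rw [h1] at h
    · norm_num at h
    · have := le_max_right 0 (|x| - ε)
      linarith
  · intro h
    rw [max_eq_left (by linarith : |x| - ε ≤ 0)]
    simp

theorem plateau_eq_zero {ε x : ℝ} (h : ε + 1 ≤ |x|) : plateau ε x = 0 := by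
  unfold plateau
  apply max_eq_left
  have := le_max_right 0 (|x| - ε)
  linarith

/-! ### Continuity of the Cayley transform in the gap metric -/

variable {H : Type*} [NormedAddCommGroup H] [InnerProductSpace ℂ H] [CompleteSpace H]

theorem cayley_addScalar {T : H →ₗ.[ℂ] H} (hT : IsSelfAdjoint T) (x : T.domain) :
    cayley T hT (addScalar T Complex.I x) = addScalar T (-Complex.I) x := by
  have h : (addIEquiv T hT).symm (addScalar T Complex.I x) = x :=
    (addIEquiv T hT).symm_apply_apply x
  change addScalar T (-Complex.I) ((addIEquiv T hT).symm (addScalar T Complex.I x)) = _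
  rw [h]

/-- With `(a, T a)` the projection of `(y, 0)`, orthogonality of the remainder to the graph puts `T
a` into the domain of the adjoint, which is that of `T`, and gives `T (T a) = y - a`. Thus `y = (T +
i)(T - i) a`, and its Cayley transform is `(T - i)² a = y - 2 a - 2 i T a`. -/
theorem cayley_apply_eq {T : H →ₗ.[ℂ] H} (hT : IsSelfAdjoint T) (y : H) :
    cayley T hT y = y - (2 : ℂ) • (graphProjection T hT (WithLp.toLp 2 (y, 0))).fst
      - (2 * Complex.I) • (graphProjection T hT (WithLp.toLp 2 (y, 0))).snd := by
  have := hasOrthogonalProjection_hilbertGraph hT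
  set w : WithLp 2 (H × H) := WithLp.toLp 2 (y, 0) with hw
  have hPw : graphProjection T hT w = (hilbertGraph T).starProjection w := rfl
  set p := graphProjection T hT w with hp
  have hpm : p ∈ hilbertGraph T := by
    rw [hPw]; exact Submodule.starProjection_apply_mem _ _
  have hq : w - p ∈ (hilbertGraph T)ᗮ := by
    rw [hPw]; exact Submodule.sub_starProjection_mem_orthogonal _
  obtain ⟨a, ha1, ha2⟩ := (LinearPMap.mem_graph_iff T).mp hpm
  have ha1' : (a : H) = p.fst := ha1
  have ha2' : T a = p.snd := ha2
  have hq' : ∀ u : T.domain, inner ℂ (y - (a : H)) (u : H) = inner ℂ (T a) (T u) := by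
    intro u
    have h : (WithLp.toLp 2 ((u : H), T u) : WithLp 2 (H × H)) ∈ hilbertGraph T :=
      LinearPMap.mem_graph T u
    have h2 := (Submodule.mem_orthogonal' _ _).mp hq _ h
    rw [WithLp.prod_inner_apply] at h2
    have h3 : inner ℂ (y - p.fst) (u : H) + inner ℂ (0 - p.snd) (T u) = 0 := h2
    rw [zero_sub, inner_neg_left] at h3
    rw [ha1', ha2']
    linear_combination h3
  have hdom : T a ∈ T.domain := by
    have := LinearPMap.mem_adjoint_domain_of_exists (T := T) (T a) ⟨_, hq'⟩
    rwa [LinearPMap.isSelfAdjoint_def.mp hT] at this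
  have hval : T ⟨T a, hdom⟩ = y - a := by
    refine hT.dense_domain.eq_of_inner_left ℂ fun v hv => ?_
    rw [inner_apply_comm hT ⟨T a, hdom⟩ ⟨v, hv⟩]
    exact (hq' ⟨v, hv⟩).symm
  -- The vector `T a - i a` is `(T - i) a`, the preimage of `y` under `T + i`.
  have hy : addScalar T Complex.I ((⟨T a, hdom⟩ : T.domain) - Complex.I • a) = y := by
    have e : addScalar T Complex.I ((⟨T a, hdom⟩ : T.domain) - Complex.I • a)
        = T ⟨T a, hdom⟩ + Complex.I • T a - Complex.I • (T a + Complex.I • (a : H)) := by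
      rw [map_sub, map_smul]; rfl
    rw [e, hval, smul_add, smul_smul, Complex.I_mul_I]
    module
  have hy2 : addScalar T (-Complex.I) ((⟨T a, hdom⟩ : T.domain) - Complex.I • a)
      = y - (2 : ℂ) • (a : H) - (2 * Complex.I) • T a := by
    have e : addScalar T (-Complex.I) ((⟨T a, hdom⟩ : T.domain) - Complex.I • a)
        = T ⟨T a, hdom⟩ + (-Complex.I) • T a - Complex.I • (T a + (-Complex.I) • (a : H)) := by
      rw [map_sub, map_smul]; rfl
    rw [e, hval, smul_add, smul_smul, mul_neg, Complex.I_mul_I]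
    module
  rw [← ha1', ← ha2', ← hy2, ← cayley_addScalar hT, hy]

namespace SAFredholm

/-- The Cayley transform of a self-adjoint Fredholm operator. -/
noncomputable abbrev cay (T : SAFredholm H) : H →L[ℂ] H := cayley T.op T.selfAdjoint

theorem continuous_cay : Continuous (cay : SAFredholm H → H →L[ℂ] H) := by
  have hP : Continuous fun T : SAFredholm H => graphProjection T.op T.selfAdjoint :=
    continuous_induced_dom
  let J : H →L[ℂ] WithLp 2 (H × H) :=
    (WithLp.prodContinuousLinearEquiv 2 ℂ H H).symm.toContinuousLinearMap ∘L
      ContinuousLinearMap.inl ℂ H H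
  let p₁ : WithLp 2 (H × H) →L[ℂ] H := ContinuousLinearMap.fst ℂ H H ∘L
    (WithLp.prodContinuousLinearEquiv 2 ℂ H H).toContinuousLinearMap
  let p₂ : WithLp 2 (H × H) →L[ℂ] H := ContinuousLinearMap.snd ℂ H H ∘L
    (WithLp.prodContinuousLinearEquiv 2 ℂ H H).toContinuousLinearMap
  have h : (cay : SAFredholm H → H →L[ℂ] H) = fun T => 1
      - (2 : ℂ) • (p₁ ∘L (graphProjection T.op T.selfAdjoint ∘L J))
      - (2 * Complex.I) • (p₂ ∘L (graphProjection T.op T.selfAdjoint ∘L J)) := by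
    funext T
    ext y
    exact cayley_apply_eq T.selfAdjoint y
  rw [h]
  have h1 : Continuous fun T : SAFredholm H => graphProjection T.op T.selfAdjoint ∘L J :=
    hP.clm_comp continuous_const
  have h2 : Continuous fun T : SAFredholm H =>
      p₁ ∘L (graphProjection T.op T.selfAdjoint ∘L J) := continuous_const.clm_comp h1
  have h3 : Continuous fun T : SAFredholm H =>
      p₂ ∘L (graphProjection T.op T.selfAdjoint ∘L J) := continuous_const.clm_comp h1
  exact (continuous_const.sub (h2.const_smul (2 : ℂ))).sub (h3.const_smul (2 * Complex.I))

end SAFredholm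

/-! ### Functional calculus with continuous functions of compact support -/

/-- Continuous functions on the real line that vanish outside a bounded set. -/
def IsCc (φ : ℝ → ℝ) : Prop := Continuous φ ∧ ∃ R, ∀ x, R ≤ |x| → φ x = 0

theorem isCc_plateau (ε : ℝ) : IsCc (plateau ε) :=
  ⟨continuous_plateau ε, ε + 1, fun _ h => plateau_eq_zero h⟩

theorem IsCc.mul_left {φ ψ : ℝ → ℝ} (hψ : IsCc ψ) (hφ : Continuous φ) :
    IsCc fun x => φ x * ψ x := by
  obtain ⟨h1, R, hR⟩ := hψ
  exact ⟨hφ.mul h1, R, fun x hx => by simp only [hR x hx, mul_zero]⟩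

theorem IsCc.sub {φ ψ : ℝ → ℝ} (hφ : IsCc φ) (hψ : IsCc ψ) : IsCc fun x => φ x - ψ x := by
  obtain ⟨h1, R, hR⟩ := hφ
  obtain ⟨h2, R', hR'⟩ := hψ
  exact ⟨h1.sub h2, max R R', fun x hx => by
    simp only [hR x ((le_max_left _ _).trans hx), hR' x ((le_max_right _ _).trans hx), sub_zero]⟩

theorem IsCc.comp_div {φ : ℝ → ℝ} (hφ : IsCc φ) {η : ℝ} (hη : 0 < η) :
    IsCc fun x => φ (x / η) := by
  obtain ⟨h1, R, hR⟩ := hφ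
  refine ⟨h1.comp (continuous_id.div_const η), R * η, fun x hx => hR _ ?_⟩
  rwa [abs_div, abs_of_pos hη, le_div_iff₀ hη]

theorem IsCc.continuousOn_onCircle {φ : ℝ → ℝ} (hφ : IsCc φ) :
    ContinuousOn (onCircle φ) (Metric.sphere (0 : ℂ) 1) := by
  obtain ⟨h1, R, hR⟩ := hφ
  exact GapSpectralFlow.continuousOn_onCircle h1 hR

namespace SAFredholm

instance isStarNormal_cay (S : SAFredholm H) : IsStarNormal S.cay :=
  ⟨(Unitary.star_mul_self_of_mem (cayley_mem_unitary S.op S.selfAdjoint)).trans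
    (Unitary.mul_star_self_of_mem (cayley_mem_unitary S.op S.selfAdjoint)).symm⟩

theorem spectrum_cay_subset (S : SAFredholm H) :
    spectrum ℂ S.cay ⊆ Metric.sphere (0 : ℂ) 1 :=
  spectrum.subset_circle_of_unitary (cayley_mem_unitary S.op S.selfAdjoint)

/-- The real spectrum of a self-adjoint operator, as seen by its Cayley transform. -/
def rspec (S : SAFredholm H) : Set ℝ := {c | kappa c ∈ spectrum ℂ S.cay}

/-- The operator `φ(S)`. -/
noncomputable abbrev fc (S : SAFredholm H) (φ : ℝ → ℝ) : H →L[ℂ] H :=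
  funCalc S.op S.selfAdjoint φ

theorem eq_one_or_kappa (S : SAFredholm H) {z : ℂ} (hz : z ∈ spectrum ℂ S.cay) :
    z = 1 ∨ ∃ c ∈ S.rspec, z = kappa c := by
  by_cases h1 : z = 1
  · exact Or.inl h1
  · obtain ⟨c, hc⟩ := exists_eq_kappa (by simpa using S.spectrum_cay_subset hz) h1
    exact Or.inr ⟨c, by rw [hc] at hz; exact hz, hc⟩

theorem fc_congr (S : SAFredholm H) {φ ψ : ℝ → ℝ} (h : ∀ c ∈ S.rspec, φ c = ψ c) :
    S.fc φ = S.fc ψ := by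
  refine cfc_congr fun z hz => ?_
  rcases S.eq_one_or_kappa hz with rfl | ⟨c, hc, rfl⟩
  · rw [onCircle_one, onCircle_one]
  · rw [onCircle_kappa, onCircle_kappa, h c hc]

theorem continuousOn_spectrum (S : SAFredholm H) {φ : ℝ → ℝ} (hφ : IsCc φ) :
    ContinuousOn (onCircle φ) (spectrum ℂ S.cay) :=
  hφ.continuousOn_onCircle.mono S.spectrum_cay_subset

theorem fc_mul (S : SAFredholm H) {φ ψ : ℝ → ℝ} (hφ : IsCc φ) (hψ : IsCc ψ) :
    S.fc φ * S.fc ψ = S.fc fun x => φ x * ψ x := by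
  unfold fc funCalc
  rw [← cfc_mul (onCircle φ) (onCircle ψ) S.cay (S.continuousOn_spectrum hφ)
    (S.continuousOn_spectrum hψ)]
  congr 1
  funext z
  unfold onCircle
  split_ifs <;> simp

theorem fc_sub (S : SAFredholm H) {φ ψ : ℝ → ℝ} (hφ : IsCc φ) (hψ : IsCc ψ) :
    S.fc φ - S.fc ψ = S.fc fun x => φ x - ψ x := by
  unfold fc funCalc
  rw [← cfc_sub (onCircle φ) (onCircle ψ) S.cay (S.continuousOn_spectrum hφ)
    (S.continuousOn_spectrum hψ)]
  congr 1
  funext z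
  unfold onCircle
  split_ifs <;> simp

theorem isSelfAdjoint_fc (S : SAFredholm H) (φ : ℝ → ℝ) : IsSelfAdjoint (S.fc φ) := by
  unfold fc funCalc
  rw [isSelfAdjoint_iff, ← cfc_star]
  congr 1
  funext z
  unfold onCircle
  split_ifs <;> simp

theorem abs_le_norm_fc (S : SAFredholm H) {φ : ℝ → ℝ} (hφ : IsCc φ) {c : ℝ} (hc : c ∈ S.rspec) :
    |φ c| ≤ ‖S.fc φ‖ := by
  have h := norm_apply_le_norm_cfc (onCircle φ) S.cay hc (S.continuousOn_spectrum hφ)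
  rwa [onCircle_kappa, Complex.norm_real, Real.norm_eq_abs] at h

/-- All the spectra lie in one compact set, the unit circle, on which the transplanted function is
continuous. This is what makes the functional calculus continuous in the operator. -/
theorem continuous_fc {φ : ℝ → ℝ} (hφ : IsCc φ) : Continuous fun S : SAFredholm H => S.fc φ :=
  Continuous.cfc' (isCompact_sphere (0 : ℂ) 1) (onCircle φ) continuous_cay spectrum_cay_subset
    hφ.continuousOn_onCircle isStarNormal_cay

theorem commute_fc (S : SAFredholm H) (φ ψ : ℝ → ℝ) : Commute (S.fc φ) (S.fc ψ) :=
  cfc_commute_cfc _ _ _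

theorem commute_fc_cay (S : SAFredholm H) (φ : ℝ → ℝ) : Commute (S.fc φ) S.cay := by
  have h := cfc_commute_cfc (onCircle φ) id S.cay
  rwa [cfc_id ℂ S.cay] at h

/-! ### The spectral projections -/

theorem tendsto_proj (S : SAFredholm H) (ε : ℝ) (x : H) :
    Tendsto (fun n : ℕ => (S.fc (plateau ε) ^ (n + 1)) x) atTop (𝓝 (S.proj ε x)) := by
  refine ((exists_spectralProjection S.op S.selfAdjoint ε).choose_spec x).congr fun n => ?_
  rw [funCalc_plateau_pow]

theorem fc_plateau_proj (S : SAFredholm H) (ε : ℝ) (x : H) :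
    S.fc (plateau ε) (S.proj ε x) = S.proj ε x := by
  have h1 := ((S.fc (plateau ε)).continuous.tendsto _).comp (S.tendsto_proj ε x)
  have h2 := (tendsto_add_atTop_iff_nat 1).mpr (S.tendsto_proj ε x)
  refine tendsto_nhds_unique h1 (h2.congr fun n => ?_)
  rw [pow_succ']
  rfl

theorem fc_plateau_pow_apply (S : SAFredholm H) {ε : ℝ} {x : H} (h : S.fc (plateau ε) x = x)
    (n : ℕ) : (S.fc (plateau ε) ^ n) x = x := by
  induction n with
  | zero => rfl
  | succ k ih => rw [pow_succ]; change (S.fc (plateau ε) ^ k) (S.fc (plateau ε) x) = x; rw [h, ih]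

/-- The limit of the powers of an operator, applied to a vector, is fixed by the operator, and a
fixed vector is its own limit. This description replaces the strong limit in most later arguments.
-/
theorem mem_range_proj_iff (S : SAFredholm H) {ε : ℝ} {x : H} :
    x ∈ (S.proj ε).range ↔ S.fc (plateau ε) x = x := by
  constructor
  · rintro ⟨y, rfl⟩
    exact S.fc_plateau_proj ε y
  · intro h
    refine ⟨x, tendsto_nhds_unique (S.tendsto_proj ε x) ?_⟩
    exact tendsto_const_nhds.congr fun n => (S.fc_plateau_pow_apply h _).symm

theorem proj_apply_of_mem (S : SAFredholm H) {ε : ℝ} {x : H} (hx : x ∈ (S.proj ε).range) :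
    S.proj ε x = x := by
  refine tendsto_nhds_unique (S.tendsto_proj ε x) ?_
  exact tendsto_const_nhds.congr fun n =>
    (S.fc_plateau_pow_apply (S.mem_range_proj_iff.mp hx) _).symm

theorem commute_proj (S : SAFredholm H) {B : H →L[ℂ] H} {ε : ℝ}
    (hB : Commute B (S.fc (plateau ε))) : Commute B (S.proj ε) := by
  ext x
  have h1 := (B.continuous.tendsto _).comp (S.tendsto_proj ε x)
  refine tendsto_nhds_unique h1 ((S.tendsto_proj ε (B x)).congr fun n => ?_)
  exact (DFunLike.congr_fun (hB.pow_right (n + 1)).eq x).symm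

theorem isIdempotentElem_proj (S : SAFredholm H) (ε : ℝ) : IsIdempotentElem (S.proj ε) := by
  ext x
  exact S.proj_apply_of_mem ⟨x, rfl⟩

/-- Functions vanishing on the part of the spectrum in `[-ε, ε]` act as `0` on the range of the
spectral projection. -/
theorem cfc_apply_eq_zero (S : SAFredholm H) {ε : ℝ} {g : ℂ → ℂ}
    (hg : ContinuousOn g (Metric.sphere (0 : ℂ) 1))
    (h0 : ∀ c ∈ S.rspec, |c| ≤ ε → g (kappa c) = 0) {x : H} (hx : x ∈ (S.proj ε).range) :
    cfc g S.cay x = 0 := by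
  have hσ : IsCompact (spectrum ℂ S.cay) := spectrum.isCompact _
  have hgσ : ContinuousOn g (spectrum ℂ S.cay) := hg.mono S.spectrum_cay_subset
  have hpσ := S.continuousOn_spectrum (isCc_plateau ε)
  have hp0 : ∀ z, 0 ≤ ‖onCircle (plateau ε) z‖ ∧ ‖onCircle (plateau ε) z‖ ≤ 1 := by
    intro z
    refine ⟨norm_nonneg _, ?_⟩
    unfold onCircle
    split_ifs
    · simp
    · rw [Complex.norm_real, Real.norm_of_nonneg (plateau_nonneg _ _)]
      exact plateau_le_one _ _
  -- Dini's theorem: the powers of the plateau decrease to `0` where it is less than `1`, and `g`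
  -- vanishes at the remaining points of the spectrum.
  have hunif : TendstoUniformlyOn
      (fun (n : ℕ) z => ‖g z‖ * ‖onCircle (plateau ε) z‖ ^ n) (fun _ => (0 : ℝ)) atTop
      (spectrum ℂ S.cay) := by
    refine Antitone.tendstoUniformlyOn_of_forall_tendsto hσ
      (fun n => hgσ.norm.mul (hpσ.norm.pow n)) (fun z _ m n hmn => ?_) continuousOn_const
      fun z hz => ?_
    · exact mul_le_mul_of_nonneg_left (pow_le_pow_of_le_one (hp0 z).1 (hp0 z).2 hmn)
        (norm_nonneg _)
    · by_cases h1 : ‖onCircle (plateau ε) z‖ = 1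
      · have hgz : g z = 0 := by
          rcases S.eq_one_or_kappa hz with rfl | ⟨c, hc, rfl⟩
          · rw [onCircle_one, norm_zero] at h1
            exact absurd h1 zero_ne_one
          · rw [onCircle_kappa, Complex.norm_real, Real.norm_of_nonneg (plateau_nonneg _ _)] at h1
            exact h0 c hc (plateau_eq_one_iff.mp h1)
        simp [hgz]
      · have := (tendsto_pow_atTop_nhds_zero_of_lt_one (hp0 z).1
          (lt_of_le_of_ne (hp0 z).2 h1)).const_mul ‖g z‖
        simpa using this
  have hle : ∀ δ > 0, ‖cfc g S.cay x‖ ≤ δ * ‖x‖ := by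
    intro δ hδ
    obtain ⟨n, hn⟩ := (Metric.tendstoUniformlyOn_iff.mp hunif δ hδ).exists
    -- The vector `x` is fixed by the plateau operator, so `g` may be multiplied by any power of the
    -- plateau without changing the value at `x`.
    have e : cfc g S.cay x = cfc (fun z => g z * onCircle (plateau ε) z ^ n) S.cay x := by
      rw [cfc_mul g (fun z => onCircle (plateau ε) z ^ n) S.cay hgσ (hpσ.pow n),
        cfc_pow (onCircle (plateau ε)) n S.cay hpσ]
      change _ = cfc g S.cay ((S.fc (plateau ε) ^ n) x)
      rw [S.fc_plateau_pow_apply (S.mem_range_proj_iff.mp hx)]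
    rw [e]
    refine (ContinuousLinearMap.le_opNorm _ _).trans
      (mul_le_mul_of_nonneg_right (norm_cfc_le hδ.le fun z hz => ?_) (norm_nonneg _))
    have := hn z hz
    rw [dist_zero_left, Real.norm_of_nonneg (by positivity)] at this
    rw [norm_mul, norm_pow]
    exact this.le
  have h3 : ‖cfc g S.cay x‖ ≤ 0 := by
    refine le_of_forall_pos_le_add fun δ hδ => ?_
    have h4 := hle (δ / (‖x‖ + 1)) (by positivity)
    have h5 : δ / (‖x‖ + 1) * ‖x‖ ≤ δ := by
      rw [div_mul_eq_mul_div, div_le_iff₀ (by positivity)]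
      nlinarith [norm_nonneg x]
    linarith
  exact norm_le_zero_iff.mp h3

theorem fc_apply_eq_zero (S : SAFredholm H) {ε : ℝ} {φ : ℝ → ℝ} (hφ : IsCc φ)
    (h0 : ∀ c ∈ S.rspec, |c| ≤ ε → φ c = 0) {x : H} (hx : x ∈ (S.proj ε).range) :
    S.fc φ x = 0 :=
  S.cfc_apply_eq_zero hφ.continuousOn_onCircle
    (fun c hc hcε => by rw [onCircle_kappa, h0 c hc hcε, Complex.ofReal_zero]) hx

theorem fc_apply_eq_self (S : SAFredholm H) {ε : ℝ} {φ : ℝ → ℝ} (hφ : IsCc φ)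
    (h1 : ∀ c ∈ S.rspec, |c| ≤ ε → φ c = 1) {x : H} (hx : x ∈ (S.proj ε).range) :
    S.fc φ x = x := by
  have h := S.fc_apply_eq_zero ((isCc_plateau ε).sub hφ)
    (fun c hc hcε => by rw [plateau_eq_one_iff.mpr hcε, h1 c hc hcε, sub_self]) hx
  rw [← S.fc_sub (isCc_plateau ε) hφ] at h
  have h2 : S.fc (plateau ε) x - S.fc φ x = 0 := h
  rw [S.mem_range_proj_iff.mp hx] at h2
  exact (sub_eq_zero.mp h2).symm

theorem range_proj_mono (S : SAFredholm H) {ε δ : ℝ} (h : δ ≤ ε) :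
    (S.proj δ).range ≤ (S.proj ε).range := fun _ hx =>
  S.mem_range_proj_iff.mpr (S.fc_apply_eq_self (isCc_plateau ε)
    (fun _ _ hc => plateau_eq_one_iff.mpr (hc.trans h)) hx)

/-! ### Eigenvectors -/

theorem cay_apply_of_eigenvector (S : SAFredholm H) {v : H} (hv : v ∈ S.op.domain) {c : ℝ}
    (h : S.op ⟨v, hv⟩ = (c : ℂ) • v) : S.cay v = kappa c • v := by
  have h1 := cayley_addScalar S.selfAdjoint ⟨v, hv⟩
  have e1 : addScalar S.op Complex.I ⟨v, hv⟩ = ((c : ℂ) + Complex.I) • v := by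
    change S.op ⟨v, hv⟩ + Complex.I • v = _
    rw [h, add_smul]
  have e2 : addScalar S.op (-Complex.I) ⟨v, hv⟩ = ((c : ℂ) - Complex.I) • v := by
    change S.op ⟨v, hv⟩ + (-Complex.I) • v = _
    rw [h]
    module
  rw [e1, e2, map_smul] at h1
  have h2 := ofReal_add_I_ne_zero c
  rw [kappa, div_eq_inv_mul, mul_smul, ← h1, smul_smul, inv_mul_cancel₀ h2, one_smul]

/-- Write `v = (S + i) x`. The eigenvalue equation of the Cayley transform makes `v` a scalar
multiple of `x`, and this is what places `v` in the domain. -/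
theorem exists_eigenvector_of_cay (S : SAFredholm H) {v : H} {c : ℝ}
    (h : S.cay v = kappa c • v) : ∃ hv : v ∈ S.op.domain, S.op ⟨v, hv⟩ = (c : ℂ) • v := by
  obtain ⟨x, hx⟩ := addScalar_surjective S.selfAdjoint Complex.I_sq v
  have h1 := cayley_addScalar S.selfAdjoint x
  rw [hx] at h1
  have h2 : S.op x + (-Complex.I) • (x : H) = kappa c • v := by rw [← h]; exact h1.symm
  have h3 : S.op x + Complex.I • (x : H) = v := hx
  have hci := ofReal_add_I_ne_zero c
  have h4 : (2 * Complex.I) • (x : H) = (1 - kappa c) • v := by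
    have : (2 * Complex.I) • (x : H)
        = (S.op x + Complex.I • (x : H)) - (S.op x + (-Complex.I) • (x : H)) := by module
    rw [this, h2, h3]
    module
  have h5 : v = ((c : ℂ) + Complex.I) • (x : H) := by
    rw [one_sub_kappa] at h4
    have hI : (2 * Complex.I) ≠ 0 := by simp
    have h6 : (x : H) = ((c : ℂ) + Complex.I)⁻¹ • v := by
      have := congrArg (fun y => (2 * Complex.I)⁻¹ • y) h4
      simp only [smul_smul, inv_mul_cancel₀ hI, one_smul] at this
      rw [this]
      congr 1
      field_simp
    rw [h6, smul_smul, mul_inv_cancel₀ hci, one_smul]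
  have h6 : S.op x = (c : ℂ) • (x : H) := by
    have : S.op x = v - Complex.I • (x : H) := by rw [← h3]; abel
    rw [this, h5]
    module
  have hv : v ∈ S.op.domain := by rw [h5]; exact S.op.domain.smul_mem _ x.2
  refine ⟨hv, ?_⟩
  have h7 : (⟨v, hv⟩ : S.op.domain) = ((c : ℂ) + Complex.I) • x := Subtype.ext h5
  rw [h7, LinearPMap.map_smul, h6, smul_comm, ← h5]

theorem mem_rspec_of_cay (S : SAFredholm H) {v : H} (hv : v ≠ 0) {c : ℝ}
    (h : S.cay v = kappa c • v) : c ∈ S.rspec := by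
  refine spectrum.mem_iff.mpr fun hu => hv ?_
  obtain ⟨u, hu⟩ := hu
  have h1 : (u : H →L[ℂ] H) v = 0 := by
    rw [hu]
    change (algebraMap ℂ (H →L[ℂ] H) (kappa c)) v - S.cay v = 0
    rw [h, Algebra.algebraMap_eq_smul_one]
    simp
  have h2 : (↑u⁻¹ * (u : H →L[ℂ] H)) v = 0 := by
    change (↑u⁻¹ : H →L[ℂ] H) ((u : H →L[ℂ] H) v) = 0
    rw [h1, map_zero]
  rwa [Units.inv_mul] at h2

/-- The evaluation rule holds for constants, for `z` and for its conjugate, and it survives sums,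
products and limits. Stone–Weierstrass then extends it to all continuous functions on the spectrum.
-/
theorem fc_apply_of_cay (S : SAFredholm H) {φ : ℝ → ℝ} (hφ : IsCc φ) {v : H} {c : ℝ}
    (h : S.cay v = kappa c • v) : S.fc φ v = (φ c : ℂ) • v := by
  by_cases hv : v = 0
  · simp [hv]
  have hmem : kappa c ∈ spectrum ℂ S.cay := S.mem_rspec_of_cay hv h
  -- Unitarity inverts the eigenvalue equation, and the inverse of a number of modulus `1` is its
  -- conjugate.
  have hstar : (star S.cay) v = star (kappa c) • v := by
    have hU := Unitary.star_mul_self_of_mem (cayley_mem_unitary S.op S.selfAdjoint)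
    have h1 : (star S.cay * S.cay) v = v := by rw [hU]; rfl
    have h2 : kappa c • (star S.cay) v = v := by
      rw [← map_smul, ← h]; exact h1
    have h3 : ‖kappa c‖ = 1 := by simpa using S.spectrum_cay_subset hmem
    have h4 : star (kappa c) * kappa c = 1 := by
      have := Complex.conj_mul' (kappa c)
      rw [h3] at this
      simpa using this
    conv_rhs => rw [← h2]
    rw [smul_smul, h4, one_smul]
  have key : ∀ f : C(spectrum ℂ S.cay, ℂ),
      cfcHom (isStarNormal_cay S) f v = f ⟨kappa c, hmem⟩ • v := by
    intro f
    have : CompactSpace (spectrum ℂ S.cay) :=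
      isCompact_iff_compactSpace.mp (spectrum.isCompact _)
    induction f using ContinuousMap.induction_on_of_compact with
    | const r =>
      have : cfcHom (isStarNormal_cay S) (ContinuousMap.const (spectrum ℂ S.cay) r)
          = algebraMap ℂ (H →L[ℂ] H) r :=
        AlgHomClass.commutes (cfcHom (isStarNormal_cay S)) r
      rw [this, Algebra.algebraMap_eq_smul_one]
      simp
    | id => rw [cfcHom_id]; exact h
    | star_id => rw [map_star, cfcHom_id]; exact hstar
    | add f g hf hg =>
      rw [map_add, add_apply, hf, hg, ContinuousMap.add_apply, add_smul]
    | mul f g hf hg =>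
      rw [map_mul, mul_apply_eq_comp, hg, map_smul, hf, ContinuousMap.mul_apply,
        smul_smul, mul_comm]
    | frequently f hf =>
      have hcl : IsClosed {f : C(spectrum ℂ S.cay, ℂ) |
          cfcHom (isStarNormal_cay S) f v = f ⟨kappa c, hmem⟩ • v} := by
        refine isClosed_eq ?_ ?_
        · exact (cfcHom_continuous (isStarNormal_cay S)).clm_apply continuous_const
        · exact (ContinuousEvalConst.continuous_eval_const _).smul continuous_const
      exact hcl.mem_of_frequently_of_tendsto hf tendsto_id
  change cfc (onCircle φ) S.cay v = _
  rw [cfc_apply (onCircle φ) S.cay (isStarNormal_cay S) (S.continuousOn_spectrum hφ), key]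
  change onCircle φ (kappa c) • v = _
  rw [onCircle_kappa]

end SAFredholm

/-! ### Ranks of nearby projections -/

/-- `P` is injective on the range of `Q`: if `Q x = x` and `P x = 0`, then `‖x‖ = ‖(P - Q) x‖ ≤ ‖P -
Q‖ ‖x‖`. -/
theorem finrank_range_le_of_norm_sub_lt_one {E : Type*} [NormedAddCommGroup E] [NormedSpace ℂ E]
    {P Q : E →L[ℂ] E}
    (hQ : IsIdempotentElem Q) (h : ‖P - Q‖ < 1) (hfin : FiniteDimensional ℂ P.range) :
    FiniteDimensional ℂ Q.range ∧ Module.finrank ℂ Q.range ≤ Module.finrank ℂ P.range := by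
  let L : Q.range →ₗ[ℂ] P.range :=
    (P.toLinearMap.rangeRestrict).comp Q.range.subtype
  have hL : Function.Injective L := by
    rw [injective_iff_map_eq_zero]
    intro x hx
    have hPx : P (x : E) = 0 := congrArg Subtype.val hx
    have hQx : Q (x : E) = x := by
      obtain ⟨y, hy⟩ := x.2
      rw [← hy]
      exact DFunLike.congr_fun hQ y
    have h1 : ‖(P - Q) (x : E)‖ ≤ ‖P - Q‖ * ‖(x : E)‖ := ContinuousLinearMap.le_opNorm _ _
    have h2 : (P - Q) (x : E) = -x := by
      change P (x : E) - Q (x : E) = -x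
      rw [hPx, hQx, zero_sub]
    rw [h2, norm_neg] at h1
    have h3 : ‖(x : E)‖ = 0 := by nlinarith [norm_nonneg (x : E)]
    exact Subtype.ext (norm_eq_zero.mp h3)
  exact ⟨FiniteDimensional.of_injective L hL, LinearMap.finrank_le_finrank_of_injective hL⟩

theorem eventually_finrank_range_eq {E : Type*} [NormedAddCommGroup E] [NormedSpace ℂ E]
    {Y : Type*} {l : Filter Y} {Q : Y → E →L[ℂ] E} {P : E →L[ℂ] E} (hQ : ∀ᶠ y in l, IsIdempotentElem (Q y)) (hP : IsIdempotentElem P)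
    (hfin : FiniteDimensional ℂ P.range) (h : Tendsto Q l (𝓝 P)) :
    ∀ᶠ y in l, FiniteDimensional ℂ (Q y).range ∧
      Module.finrank ℂ (Q y).range = Module.finrank ℂ P.range := by
  filter_upwards [hQ, Metric.tendsto_nhds.mp h 1 one_pos] with y hy hd
  rw [dist_eq_norm] at hd
  obtain ⟨h1, h2⟩ := finrank_range_le_of_norm_sub_lt_one hy (by rwa [norm_sub_rev]) hfin
  exact ⟨h1, le_antisymm h2 (finrank_range_le_of_norm_sub_lt_one hP hd h1).2⟩

namespace SAFredholm

/-! ### The kernel is isolated in the spectrum -/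

/-- The kernel of `S`, as a subspace of `H`. -/
def kerSpace (S : SAFredholm H) : Submodule ℂ H :=
  (LinearMap.ker S.op.toFun).map S.op.domain.subtype

theorem mem_kerSpace_iff (S : SAFredholm H) {v : H} :
    v ∈ S.kerSpace ↔ S.cay v = kappa 0 • v := by
  constructor
  · rintro ⟨x, hx, rfl⟩
    refine S.cay_apply_of_eigenvector x.2 ?_
    rw [Complex.ofReal_zero, zero_smul]
    exact hx
  · intro h
    obtain ⟨hv, h1⟩ := S.exists_eigenvector_of_cay h
    rw [Complex.ofReal_zero, zero_smul] at h1
    exact ⟨⟨v, hv⟩, h1, rfl⟩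

theorem finrank_kerSpace (S : SAFredholm H) :
    Module.finrank ℂ S.kerSpace = S.kerDim :=
  (Submodule.equivMapOfInjective _ S.op.domain.injective_subtype _).symm.finrank_eq

theorem finiteDimensional_kerSpace (S : SAFredholm H) :
    FiniteDimensional ℂ S.kerSpace :=
  have := S.fredholm.finite_ker
  inferInstanceAs
    (FiniteDimensional ℂ ((LinearMap.ker S.op.toFun).map S.op.domain.subtype))

/-- Since `(1 + U)(S + i) x = 2 S x` for the Cayley transform `U`, the Fredholm hypothesis on the
range passes to a bounded operator. -/
theorem range_one_add_cay (S : SAFredholm H) :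
    (1 + S.cay).range = LinearMap.range S.op.toFun := by
  have key : ∀ x : S.op.domain,
      (1 + S.cay) (addScalar S.op Complex.I x) = (2 : ℂ) • S.op x := by
    intro x
    change addScalar S.op Complex.I x + S.cay (addScalar S.op Complex.I x) = _
    rw [cayley_addScalar]
    change (S.op x + Complex.I • (x : H)) + (S.op x + (-Complex.I) • (x : H)) = _
    module
  ext y
  constructor
  · rintro ⟨w, rfl⟩
    obtain ⟨x, rfl⟩ := addScalar_surjective S.selfAdjoint Complex.I_sq w
    exact ⟨(2 : ℂ) • x, (LinearMap.map_smul _ _ _).trans (key x).symm⟩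
  · rintro ⟨x, rfl⟩
    refine ⟨addScalar S.op Complex.I ((2 : ℂ)⁻¹ • x), (key _).trans ?_⟩
    change (2 : ℂ) • S.op.toFun ((2 : ℂ)⁻¹ • x) = _
    rw [map_smul, smul_smul, mul_inv_cancel₀ two_ne_zero, one_smul]

/-- A bounded operator with closed range is bounded below on the orthogonal complement of its
kernel. -/
theorem exists_norm_le_mul_norm_one_add_cay (S : SAFredholm H) :
    ∃ C > 0, ∀ x ∈ ((1 + S.cay).ker)ᗮ, ‖x‖ ≤ C * ‖(1 + S.cay) x‖ := by
  set B : H →L[ℂ] H := 1 + S.cay with hB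
  have : CompleteSpace B.ker := B.isClosed_ker.completeSpace_coe
  let f : (B.ker)ᗮ →L[ℂ] H := B ∘L (B.ker)ᗮ.subtypeL
  have hinj : Function.Injective f := by
    rw [injective_iff_map_eq_zero]
    intro x hx
    have h1 : (x : H) ∈ B.ker := hx
    have h2 := (Submodule.mem_orthogonal _ _).mp x.2 _ h1
    exact Subtype.ext (inner_self_eq_zero.mp h2)
  have hran : Set.range f = (B.range : Set H) := by
    ext y
    constructor
    · rintro ⟨x, rfl⟩
      exact ⟨(x : H), rfl⟩
    · rintro ⟨w, rfl⟩
      refine ⟨⟨w - B.ker.starProjection w, B.ker.sub_starProjection_mem_orthogonal w⟩, ?_⟩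
      change B (w - B.ker.starProjection w) = B w
      have : B (B.ker.starProjection w) = 0 := B.ker.starProjection_apply_mem w
      rw [map_sub, this, sub_zero]
  have hcl : IsClosed (Set.range f) := by
    rw [hran, hB, S.range_one_add_cay]
    exact S.fredholm.isClosed_range
  obtain ⟨K, hK⟩ := f.antilipschitz_of_injective_of_isClosed_range hinj hcl
  refine ⟨K + 1, by positivity, fun x hx => ?_⟩
  have h1 := hK.le_mul_dist ⟨x, hx⟩ 0
  rw [map_zero, dist_zero_right, dist_zero_right] at h1
  have h2 : ‖x‖ ≤ K * ‖B x‖ := h1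
  nlinarith [norm_nonneg (B x)]

theorem norm_one_add_kappa_le (c : ℝ) : ‖1 + kappa c‖ ≤ 2 * |c| := by
  have h1 : 1 ≤ ‖(c : ℂ) + Complex.I‖ := by
    have := Complex.abs_im_le_norm ((c : ℂ) + Complex.I)
    simpa using this
  rw [one_add_kappa, norm_div, norm_mul, Complex.norm_real, Complex.norm_ofNat, Real.norm_eq_abs]
  exact div_le_self (by positivity) h1

/-- Cut the identity function off near `0` to get `b`. The range of `b(S)` is orthogonal to the
kernel, where `1 + U` is bounded below, yet `1 + U` is small on spectral subspaces close to `0`. For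
a narrow cutoff this forces `b(S) = 0`, so `b` vanishes on the spectrum. -/
theorem exists_isolated (S : SAFredholm H) : ∃ r > 0, ∀ c ∈ S.rspec, |c| < r → c = 0 := by
  obtain ⟨C, hC, hbound⟩ := S.exists_norm_le_mul_norm_one_add_cay
  -- On the support of `χ` one has `‖1 + κ(x)‖ ≤ 2 |x| ≤ 6 r`, and this choice makes `C * (6 * r) =
  -- 1 / 2`.
  set r : ℝ := 1 / (12 * C) with hr
  have hr0 : 0 < r := by positivity
  refine ⟨r, hr0, fun c hc hcr => ?_⟩
  let b : ℝ → ℝ := fun x => x * plateau 1 (x / r)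
  let χ : ℝ → ℝ := fun x => plateau 2 (x / r)
  have hb : IsCc b := ((isCc_plateau 1).comp_div hr0).mul_left continuous_id
  have hχ : IsCc χ := (isCc_plateau 2).comp_div hr0
  have hbχ : (fun x => χ x * b x) = b := by
    funext x
    change plateau 2 (x / r) * (x * plateau 1 (x / r)) = x * plateau 1 (x / r)
    rcases le_or_gt |x / r| 2 with h | h
    · rw [plateau_eq_one_iff.mpr h, one_mul]
    · rw [plateau_eq_zero (by linarith : (1 : ℝ) + 1 ≤ |x / r|)]
      ring
  have hprod : S.fc χ * S.fc b = S.fc b := by rw [S.fc_mul hχ hb, hbχ]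
  have hsmall : ‖(1 + S.cay) * S.fc χ‖ ≤ 6 * r := by
    have hχσ := S.continuousOn_spectrum hχ
    have e : (1 + S.cay) * S.fc χ = cfc (fun z => (1 + z) * onCircle χ z) S.cay := by
      rw [cfc_mul (fun z => 1 + z) (onCircle χ) S.cay (by fun_prop) hχσ,
        cfc_const_add (1 : ℂ) (fun z => z) S.cay, cfc_id' ℂ S.cay, map_one]
      rfl
    rw [e]
    refine norm_cfc_le (by positivity) fun z hz => ?_
    rcases S.eq_one_or_kappa hz with rfl | ⟨x, hx, rfl⟩
    · rw [onCircle_one, mul_zero, norm_zero]; positivity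
    · rw [onCircle_kappa, norm_mul, Complex.norm_real, Real.norm_of_nonneg (plateau_nonneg _ _)]
      change _ * χ x ≤ _
      rcases le_or_gt 3 |x / r| with h | h
      · have : χ x = 0 := plateau_eq_zero (by linarith)
        rw [this, mul_zero]; positivity
      · have h1 := norm_one_add_kappa_le x
        have h2 : χ x ≤ 1 := plateau_le_one _ _
        have h3 : 0 ≤ χ x := plateau_nonneg _ _
        rw [abs_div, abs_of_pos hr0, div_lt_iff₀ hr0] at h
        have h4 := norm_nonneg (1 + kappa x)
        nlinarith
  have hzero : S.fc b = 0 := by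
    ext y
    have hmem : S.fc b y ∈ ((1 + S.cay).ker)ᗮ := by
      refine (Submodule.mem_orthogonal _ _).mpr fun k hk => ?_
      have hk' : S.cay k = kappa 0 • k := by
        have h1 : k + S.cay k = 0 := hk
        rw [kappa_zero, neg_smul, one_smul]
        exact (neg_eq_of_add_eq_zero_right h1).symm
      have h2 : S.fc b k = 0 := by
        rw [S.fc_apply_of_cay hb hk']
        simp [b]
      have h3 := (S.isSelfAdjoint_fc b).isSymmetric k y
      have h4 : inner ℂ (S.fc b k) y = inner ℂ k (S.fc b y) := h3
      rw [← h4, h2, inner_zero_left]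
    have h1 := hbound _ hmem
    have h2 : (1 + S.cay) (S.fc b y) = ((1 + S.cay) * S.fc χ) (S.fc b y) := by
      change _ = (1 + S.cay) ((S.fc χ * S.fc b) y)
      rw [hprod]
    have h3 : ‖(1 + S.cay) (S.fc b y)‖ ≤ 6 * r * ‖S.fc b y‖ := by
      rw [h2]
      exact (ContinuousLinearMap.le_opNorm _ _).trans
        (mul_le_mul_of_nonneg_right hsmall (norm_nonneg _))
    have h4 : C * (6 * r) = 1 / 2 := by rw [hr]; field_simp; norm_num
    have h5 : ‖S.fc b y‖ ≤ 1 / 2 * ‖S.fc b y‖ := by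
      rw [← h4, mul_assoc]
      exact h1.trans (mul_le_mul_of_nonneg_left h3 hC.le)
    have h6 : ‖S.fc b y‖ = 0 := by nlinarith [norm_nonneg (S.fc b y)]
    rw [norm_eq_zero.mp h6]
    rfl
  have h1 := S.abs_le_norm_fc hb hc
  rw [hzero, norm_zero] at h1
  have h2 : b c = c := by
    have : |c / r| ≤ 1 := by
      rw [abs_div, abs_of_pos hr0, div_le_one hr0]; exact hcr.le
    change c * plateau 1 (c / r) = c
    rw [plateau_eq_one_iff.mpr this, mul_one]
  rw [h2] at h1
  exact abs_eq_zero.mp (le_antisymm h1 (abs_nonneg c))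

/-! ### Eigenvectors span the ranges of the spectral projections of finite rank -/

/-- On the range of the spectral projection the bounded operator with symbol `x * plateau ε x` acts
as `S` itself. There the identity `(x + i) κ(x) = x - i` on `[-ε, ε]` becomes an operator identity.
-/
theorem cay_apply_of_fc_apply (S : SAFredholm H) {ε : ℝ} {v : H} (hv : v ∈ (S.proj ε).range)
    {c : ℝ} (h : S.fc (fun x => x * plateau ε x) v = (c : ℂ) • v) : S.cay v = kappa c • v := by
  set φ : ℝ → ℝ := fun x => x * plateau ε x with hφdef
  have hφ : IsCc φ := (isCc_plateau ε).mul_left continuous_id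
  have hφσ := S.continuousOn_spectrum hφ
  have h0 := S.cfc_apply_eq_zero (ε := ε)
    (g := fun z => (onCircle φ z + Complex.I) * z - (onCircle φ z - Complex.I))
    (((hφ.continuousOn_onCircle.add continuousOn_const).mul continuousOn_id).sub
      (hφ.continuousOn_onCircle.sub continuousOn_const))
    (fun x _ hx => by
      have h1 := ofReal_add_I_ne_zero x
      have h2 : φ x = x := by rw [hφdef]; simp only [plateau_eq_one_iff.mpr hx, mul_one]
      rw [onCircle_kappa, h2, kappa]
      field_simp
      ring) hv
  have e : cfc (fun z => (onCircle φ z + Complex.I) * z - (onCircle φ z - Complex.I)) S.cay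
      = (S.fc φ + Complex.I • 1) * S.cay - (S.fc φ - Complex.I • 1) := by
    rw [cfc_sub (fun z => (onCircle φ z + Complex.I) * z) (fun z => onCircle φ z - Complex.I) S.cay
        ((hφσ.add continuousOn_const).mul continuousOn_id) (hφσ.sub continuousOn_const),
      cfc_mul (fun z => onCircle φ z + Complex.I) (fun z => z) S.cay
        (hφσ.add continuousOn_const) continuousOn_id,
      cfc_add S.cay (fun z => onCircle φ z) (fun _ => Complex.I) hφσ continuousOn_const,
      cfc_sub (fun z => onCircle φ z) (fun _ => Complex.I) S.cay hφσ continuousOn_const,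
      cfc_id' ℂ S.cay, cfc_const Complex.I S.cay, Algebra.algebraMap_eq_smul_one]
    rfl
  rw [e] at h0
  have h1 : S.fc φ (S.cay v) + Complex.I • S.cay v - (S.fc φ v - Complex.I • v) = 0 := h0
  have h2 : S.fc φ (S.cay v) = S.cay (S.fc φ v) :=
    DFunLike.congr_fun (S.commute_fc_cay φ).eq v
  rw [h2, h, map_smul] at h1
  have h3 : ((c : ℂ) + Complex.I) • S.cay v = ((c : ℂ) - Complex.I) • v := by
    rw [← sub_eq_zero, ← h1]
    module
  have h4 := ofReal_add_I_ne_zero c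
  rw [kappa, div_eq_inv_mul, mul_smul, ← h3, smul_smul, inv_mul_cancel₀ h4, one_smul]

/-- The bounded self-adjoint stand-in for `S` restricts to the invariant finite-dimensional space
`W`, where it has an orthonormal basis of eigenvectors. -/
theorem le_span_eigenvectors (S : SAFredholm H) {ε : ℝ} {W : Submodule ℂ H}
    (hfin : FiniteDimensional ℂ W) (hW : W ≤ (S.proj ε).range)
    (hinv : ∀ x ∈ W, S.fc (fun x => x * plateau ε x) x ∈ W) :
    W ≤ Submodule.span ℂ {v | v ∈ W ∧ ∃ c : ℝ, S.cay v = kappa c • v} := by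
  set A := S.fc (fun x => x * plateau ε x) with hA
  let R : W →ₗ[ℂ] W := A.toLinearMap.restrict hinv
  have hR : R.IsSymmetric := fun x y =>
    (S.isSelfAdjoint_fc (fun x => x * plateau ε x)).isSymmetric (x : H) (y : H)
  intro x hx
  have h1 := (hR.eigenvectorBasis rfl).sum_repr ⟨x, hx⟩
  have h2 : x = ∑ i, (hR.eigenvectorBasis rfl).repr ⟨x, hx⟩ i •
      ((hR.eigenvectorBasis rfl i : W) : H) := by
    have := congrArg Subtype.val h1
    simpa using this.symm
  rw [h2]
  refine Submodule.sum_mem _ fun i _ => Submodule.smul_mem _ _ (Submodule.subset_span ?_)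
  refine ⟨(hR.eigenvectorBasis rfl i).2, hR.eigenvalues rfl i, ?_⟩
  refine S.cay_apply_of_fc_apply (hW (hR.eigenvectorBasis rfl i).2) ?_
  exact congrArg Subtype.val (hR.apply_eigenvectorBasis rfl i)

theorem nonnegSubspace_eq (S : SAFredholm H) (ε : ℝ) : S.nonnegSubspace ε =
    Submodule.span ℂ {v | v ∈ (S.proj ε).range ∧ ∃ c : ℝ, 0 ≤ c ∧ S.cay v = kappa c • v} := by
  unfold nonnegSubspace
  congr 1
  ext v
  constructor
  · rintro ⟨h, hv, c, hc, h1⟩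
    exact ⟨h, c, hc, S.cay_apply_of_eigenvector hv h1⟩
  · rintro ⟨h, c, hc, h1⟩
    obtain ⟨hv, h2⟩ := S.exists_eigenvector_of_cay h1
    exact ⟨h, hv, c, hc, h2⟩

theorem nonnegSubspace_le (S : SAFredholm H) (ε : ℝ) :
    S.nonnegSubspace ε ≤ (S.proj ε).range :=
  Submodule.span_le.mpr fun _ hv => hv.1

/-! ### Local continuity of the spectral projections -/

/-- The real spectrum of `S` has no points `c` with `η < |c| < 2 η`. -/
def IsGap (S : SAFredholm H) (η : ℝ) : Prop := ∀ c ∈ S.rspec, η < |c| → 2 * η ≤ |c|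

/-- The only possible point of the real spectrum of `S` in `(-3 η, 3 η)` is `0`. -/
def Isolating (S : SAFredholm H) (η : ℝ) : Prop := 0 < η ∧ ∀ c ∈ S.rspec, |c| < 3 * η → c = 0

theorem exists_isolating (S : SAFredholm H) {r : ℝ} (hr : 0 < r) : ∃ η ≤ r, S.Isolating η := by
  obtain ⟨s, hs, h⟩ := S.exists_isolated
  refine ⟨min r (s / 3), min_le_left _ _, lt_min hr (by positivity), fun c hc h1 => h c hc ?_⟩
  have := min_le_right r (s / 3)
  linarith

theorem Isolating.isGap {S : SAFredholm H} {η : ℝ} (h : S.Isolating η) : S.IsGap η := by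
  intro c hc hη
  by_contra hlt
  push Not at hlt
  have h0 := h.1
  have h1 := h.2 c hc (by linarith)
  rw [h1, abs_zero] at hη
  linarith

/-- The test function `b` vanishes on the spectrum of `T` but exceeds `1` on `η < |c| < 2 η`. Since
`b(T) = 0`, nearby operators satisfy `‖b(S)‖ < 1` and cannot have spectrum in that region. -/
theorem Isolating.eventually_isGap {T : SAFredholm H} {η : ℝ} (h : T.Isolating η) :
    ∀ᶠ S in 𝓝 T, S.IsGap η := by
  obtain ⟨hη, hiso⟩ := h
  let b : ℝ → ℝ := fun x => |x| / η * plateau 2 (x / η)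
  have hb : IsCc b := ((isCc_plateau 2).comp_div hη).mul_left (by fun_prop)
  have hT : T.fc b = 0 := by
    have h1 : T.fc b = T.fc fun _ => 0 := T.fc_congr fun c hc => by
      rcases lt_or_ge |c| (3 * η) with h2 | h2
      · simp [b, hiso c hc h2]
      · have : plateau 2 (c / η) = 0 := plateau_eq_zero (by
          rw [abs_div, abs_of_pos hη, le_div_iff₀ hη]; linarith)
        simp only [b, this, mul_zero]
    rw [h1]
    have h2 : onCircle (fun _ => 0) = fun _ => (0 : ℂ) := by
      funext z
      unfold onCircle
      split_ifs <;> simp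
    unfold fc funCalc
    rw [h2]
    exact cfc_const_zero ℂ _
  have hev := Metric.tendsto_nhds.mp ((continuous_fc hb).tendsto T) 1 one_pos
  filter_upwards [hev] with S hS c hc hcη
  rw [hT, dist_zero_right] at hS
  by_contra hlt
  push Not at hlt
  have h1 := S.abs_le_norm_fc hb hc
  have h2 : b c = |c| / η := by
    have : plateau 2 (c / η) = 1 := plateau_eq_one_iff.mpr (by
      rw [abs_div, abs_of_pos hη, div_le_iff₀ hη]; linarith)
    simp only [b, this, mul_one]
  have h3 : 1 < |c| / η := by rwa [one_lt_div hη]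
  rw [h2] at h1
  have := le_abs_self (|c| / η)
  linarith

/-- The rescaled plateau falls from `1` to `0` entirely inside the gap, so on the spectrum it is the
indicator function of `[-η, η]`. The two operators absorb each other and commute, hence agree. -/
theorem IsGap.proj_eq {S : SAFredholm H} {η : ℝ} (h : S.IsGap η) (hη : 0 < η) :
    S.proj η = S.fc fun x => plateau 1 (x / η) := by
  have hφ : IsCc fun x => plateau 1 (x / η) := (isCc_plateau 1).comp_div hη
  have h1 : ∀ c, |c| ≤ η → plateau 1 (c / η) = 1 := fun c hc =>
    plateau_eq_one_iff.mpr (by rwa [abs_div, abs_of_pos hη, div_le_one hη])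
  have h2 : (S.fc fun x => plateau 1 (x / η)) * S.proj η = S.proj η := by
    ext x
    exact S.fc_apply_eq_self hφ (fun c _ hc => h1 c hc) ⟨x, rfl⟩
  have h3 : S.proj η * (S.fc fun x => plateau 1 (x / η)) = S.fc fun x => plateau 1 (x / η) := by
    ext x
    refine S.proj_apply_of_mem (S.mem_range_proj_iff.mpr ?_)
    have e : S.fc (plateau η) * (S.fc fun x => plateau 1 (x / η))
        = S.fc fun x => plateau 1 (x / η) := by
      rw [S.fc_mul (isCc_plateau η) hφ]
      refine S.fc_congr fun c hc => ?_
      rcases le_or_gt |c| η with hcη | hcη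
      · rw [plateau_eq_one_iff.mpr hcη, one_mul]
      · have : plateau 1 (c / η) = 0 := plateau_eq_zero (by
          rw [abs_div, abs_of_pos hη, le_div_iff₀ hη]
          have := h c hc hcη
          linarith)
        rw [this, mul_zero]
    exact DFunLike.congr_fun e x
  have h4 := S.commute_proj (S.commute_fc (fun x => plateau 1 (x / η)) (plateau η))
  rw [← h2, h4.eq, h3]

theorem kerSpace_le_range_proj (S : SAFredholm H) {ε : ℝ} (hε : 0 ≤ ε) :
    S.kerSpace ≤ (S.proj ε).range := by
  intro v hv
  rw [mem_range_proj_iff, S.fc_apply_of_cay (isCc_plateau ε) (S.mem_kerSpace_iff.mp hv),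
    plateau_eq_one_iff.mpr (by simpa using hε), Complex.ofReal_one, one_smul]

theorem Isolating.range_proj_eq {S : SAFredholm H} {η : ℝ} (h : S.Isolating η) :
    (S.proj η).range = S.kerSpace := by
  refine le_antisymm (fun v hv => ?_) (S.kerSpace_le_range_proj h.1.le)
  have h1 := S.cfc_apply_eq_zero (ε := η) (g := fun z => 1 + z) (by fun_prop)
    (fun c hc hcη => by
      have h0 := h.1
      rw [h.2 c hc (by linarith), kappa_zero, add_neg_cancel]) hv
  rw [cfc_const_add (1 : ℂ) (fun z => z) S.cay, cfc_id' ℂ S.cay, map_one] at h1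
  have h2 : v + S.cay v = 0 := h1
  rw [mem_kerSpace_iff, kappa_zero, neg_smul, one_smul]
  exact (neg_eq_of_add_eq_zero_right h2).symm

theorem Isolating.eventually_continuousAt {T : SAFredholm H} {η : ℝ} (h : T.Isolating η) :
    ∀ᶠ S in 𝓝 T, ContinuousAt (fun S : SAFredholm H => S.proj η) S := by
  filter_upwards [h.eventually_isGap.eventually_nhds] with S hS
  refine (continuous_fc ((isCc_plateau 1).comp_div h.1)).continuousAt.congr ?_
  filter_upwards [hS] with S' hS'
  exact (hS'.proj_eq h.1).symm

/-- At `T` the range is exactly the kernel, and norm-close projections have the same rank. -/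
theorem Isolating.eventually_finrank {T : SAFredholm H} {η : ℝ} (h : T.Isolating η) :
    ∀ᶠ S in 𝓝 T, FiniteDimensional ℂ (S.proj η).range ∧
      Module.finrank ℂ (S.proj η).range = T.kerDim := by
  have h1 : FiniteDimensional ℂ (T.proj η).range := by
    rw [h.range_proj_eq]; exact T.finiteDimensional_kerSpace
  have h2 := eventually_finrank_range_eq
    (Eventually.of_forall fun S : SAFredholm H => S.isIdempotentElem_proj η)
    (T.isIdempotentElem_proj η) h1 h.eventually_continuousAt.self_of_nhds
  rwa [h.range_proj_eq, finrank_kerSpace] at h2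

/-! ### Local constancy of differences of dimensions -/

/-- A continuous function which vanishes on `(-∞, η]` and is equal to `1` on `[2 η, ε]`. -/
noncomputable def posCut (η ε x : ℝ) : ℝ := max 0 (min 1 ((x - η) / η)) * plateau ε x

theorem isCc_posCut (η ε : ℝ) : IsCc (posCut η ε) :=
  (isCc_plateau ε).mul_left (by fun_prop)

theorem posCut_of_le {η : ℝ} (hη : 0 < η) (ε : ℝ) {x : ℝ} (h : x ≤ η) : posCut η ε x = 0 := by
  have h1 : (x - η) / η ≤ 0 := div_nonpos_of_nonpos_of_nonneg (by linarith) hη.le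
  rw [posCut, max_eq_left ((min_le_right _ _).trans h1), zero_mul]

theorem posCut_of_ge {η : ℝ} (hη : 0 < η) {ε x : ℝ} (h : 2 * η ≤ x) (hε : |x| ≤ ε) :
    posCut η ε x = 1 := by
  have h1 : 1 ≤ (x - η) / η := by rw [le_div_iff₀ hη]; linarith
  rw [posCut, min_eq_left h1, max_eq_right zero_le_one, plateau_eq_one_iff.mpr hε, one_mul]

theorem IsGap.posCut_eq {S : SAFredholm H} {η : ℝ} (h : S.IsGap η) (hη : 0 < η) {ε c : ℝ}
    (hc : c ∈ S.rspec) (hε : |c| ≤ ε) : c ≤ η ∧ posCut η ε c = 0 ∨ η < c ∧ posCut η ε c = 1 := by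
  rcases le_or_gt c η with h1 | h1
  · exact Or.inl ⟨h1, posCut_of_le hη ε h1⟩
  · have h2 : |c| = c := abs_of_pos (hη.trans h1)
    have h3 := h c hc (by rwa [h2])
    rw [h2] at h3
    exact Or.inr ⟨h1, posCut_of_ge hη h3 hε⟩

/-- The spectral projection `1_{(η, ε]}(S)`, for `η` in a gap of the spectrum. -/
noncomputable def posProj (S : SAFredholm H) (η ε : ℝ) : H →L[ℂ] H :=
  S.fc (posCut η ε) * S.proj ε

theorem commute_fc_proj (S : SAFredholm H) (φ : ℝ → ℝ) (ε : ℝ) :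
    Commute (S.fc φ) (S.proj ε) :=
  S.commute_proj (S.commute_fc φ (plateau ε))

theorem IsGap.fc_posCut_fc_posCut {S : SAFredholm H} {η ε : ℝ} (h : S.IsGap η) (hη : 0 < η)
    {x : H} (hx : x ∈ (S.proj ε).range) :
    S.fc (posCut η ε) (S.fc (posCut η ε) x) = S.fc (posCut η ε) x := by
  have hφ := isCc_posCut η ε
  have h1 := S.fc_apply_eq_zero (φ := fun c => posCut η ε c * posCut η ε c - posCut η ε c)
    ((hφ.mul_left hφ.1).sub hφ) (fun c hc hcε => by
      rcases h.posCut_eq hη hc hcε with h1 | h1 <;> simp [h1.2]) hx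
  rw [← S.fc_sub (hφ.mul_left hφ.1) hφ, ← S.fc_mul hφ hφ] at h1
  exact sub_eq_zero.mp h1

theorem IsGap.mem_range_posProj_iff {S : SAFredholm H} {η ε : ℝ} (h : S.IsGap η) (hη : 0 < η)
    {x : H} : x ∈ (S.posProj η ε).range ↔ x ∈ (S.proj ε).range ∧ S.fc (posCut η ε) x = x := by
  constructor
  · rintro ⟨y, rfl⟩
    refine ⟨⟨S.fc (posCut η ε) y, ?_⟩, h.fc_posCut_fc_posCut hη ⟨y, rfl⟩⟩
    exact (DFunLike.congr_fun (S.commute_fc_proj (posCut η ε) ε).eq y).symm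
  · rintro ⟨h1, h2⟩
    refine ⟨x, ?_⟩
    change S.fc (posCut η ε) (S.proj ε x) = x
    rw [S.proj_apply_of_mem h1, h2]

theorem IsGap.isIdempotentElem_posProj {S : SAFredholm H} {η : ℝ} (h : S.IsGap η) (hη : 0 < η)
    (ε : ℝ) : IsIdempotentElem (S.posProj η ε) := by
  ext x
  have h1 := (h.mem_range_posProj_iff hη (ε := ε)).mp ⟨x, rfl⟩
  exact (congrArg (S.fc (posCut η ε)) (S.proj_apply_of_mem h1.1)).trans h1.2

/-- The non-negative eigenvectors in the window of `ε` split into those with eigenvalue at most `η`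
and those above `η`. The gap makes `posCut` exactly `0` on the former and `1` on the latter, so the
two spans are independent. -/
theorem IsGap.nonnegDim_eq {S : SAFredholm H} {η ε : ℝ} (h : S.IsGap η) (hη : 0 < η)
    (hle : η ≤ ε) (hfin : FiniteDimensional ℂ (S.proj ε).range) :
    S.nonnegDim ε = S.nonnegDim η + Module.finrank ℂ (S.posProj η ε).range := by
  set W := (S.posProj η ε).range with hWdef
  have hW : W ≤ (S.proj ε).range := fun x hx => ((h.mem_range_posProj_iff hη).mp hx).1
  have hV : S.nonnegSubspace η ≤ (S.proj ε).range :=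
    (S.nonnegSubspace_le η).trans (S.range_proj_mono hle)
  have hWfin : FiniteDimensional ℂ W := Submodule.finiteDimensional_of_le hW
  have hVfin : FiniteDimensional ℂ (S.nonnegSubspace η) := Submodule.finiteDimensional_of_le hV
  have hsup : S.nonnegSubspace ε = S.nonnegSubspace η ⊔ W := by
    apply le_antisymm
    · rw [nonnegSubspace_eq, Submodule.span_le]
      rintro v ⟨hv, c, hc, hUv⟩
      by_cases hv0 : v = 0
      · rw [hv0]; exact Submodule.zero_mem _
      have hcs := S.mem_rspec_of_cay hv0 hUv
      -- The plateau operator fixes `v` and also multiplies it by `plateau ε c`, which equals `1`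
      -- only on `[-ε, ε]`.
      have hcε : |c| ≤ ε := by
        have h1 := S.mem_range_proj_iff.mp hv
        rw [S.fc_apply_of_cay (isCc_plateau ε) hUv] at h1
        have h2 : ((plateau ε c : ℂ) - 1) • v = 0 := by rw [sub_smul, h1, one_smul, sub_self]
        have h3 : (plateau ε c : ℂ) = 1 :=
          sub_eq_zero.mp ((smul_eq_zero.mp h2).resolve_right hv0)
        exact plateau_eq_one_iff.mp (by exact_mod_cast h3)
      rcases h.posCut_eq hη hcs hcε with h1 | h1
      · refine Submodule.mem_sup_left ?_
        rw [nonnegSubspace_eq]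
        refine Submodule.subset_span ⟨S.mem_range_proj_iff.mpr ?_, c, hc, hUv⟩
        rw [S.fc_apply_of_cay (isCc_plateau η) hUv,
          plateau_eq_one_iff.mpr (by rw [abs_of_nonneg hc]; exact h1.1), Complex.ofReal_one,
          one_smul]
      · refine Submodule.mem_sup_right ((h.mem_range_posProj_iff hη).mpr ⟨hv, ?_⟩)
        rw [S.fc_apply_of_cay (isCc_posCut η ε) hUv, h1.2, Complex.ofReal_one, one_smul]
    · refine sup_le ?_ ?_
      · rw [nonnegSubspace_eq, nonnegSubspace_eq]
        exact Submodule.span_mono fun v hv => ⟨S.range_proj_mono hle hv.1, hv.2⟩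
      · refine (S.le_span_eigenvectors (ε := ε) hWfin hW fun x hx => ?_).trans ?_
        · rw [hWdef, h.mem_range_posProj_iff hη] at hx ⊢
          refine ⟨⟨S.fc (fun x => x * plateau ε x) x, ?_⟩, ?_⟩
          · have := DFunLike.congr_fun (S.commute_fc_proj (fun x => x * plateau ε x) ε).eq x
            refine this.symm.trans ?_
            change S.fc _ (S.proj ε x) = _
            rw [S.proj_apply_of_mem hx.1]
          · have := DFunLike.congr_fun
              (S.commute_fc (posCut η ε) (fun x => x * plateau ε x)).eq x
            refine this.trans ?_
            change S.fc _ (S.fc (posCut η ε) x) = _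
            rw [hx.2]
        · rw [Submodule.span_le]
          rintro v ⟨hv, c, hUv⟩
          by_cases hv0 : v = 0
          · rw [hv0]; exact Submodule.zero_mem _
          have hv2 := (h.mem_range_posProj_iff hη).mp hv
          rw [nonnegSubspace_eq]
          refine Submodule.subset_span ⟨hv2.1, c, ?_, hUv⟩
          -- A negative eigenvalue would be annihilated by `posCut`, which fixes `v`.
          by_contra hc
          push Not at hc
          have h1 := hv2.2
          rw [S.fc_apply_of_cay (isCc_posCut η ε) hUv, posCut_of_le hη ε (by linarith),
            Complex.ofReal_zero, zero_smul] at h1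
          exact hv0 h1.symm
  have hinf : S.nonnegSubspace η ⊓ W = ⊥ := by
    rw [eq_bot_iff]
    rintro x ⟨h1, h2⟩
    have h3 := S.fc_apply_eq_zero (isCc_posCut η ε)
      (fun c _ hc => posCut_of_le hη ε ((le_abs_self c).trans hc)) (S.nonnegSubspace_le η h1)
    rw [((h.mem_range_posProj_iff hη).mp h2).2] at h3
    exact h3
  have := Submodule.finrank_sup_add_finrank_inf_eq (S.nonnegSubspace η) W
  rw [hinf, finrank_bot, add_zero, ← hsup] at this
  exact this

/-- Both sides are ranks of the projections `posProj`, which converge in norm along `l`. A general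
filter is used since a partition gives continuity only within a closed subinterval. -/
theorem Isolating.eventually_nonnegDim_sub {T : SAFredholm H} {η ε : ℝ} (h : T.Isolating η)
    (hle : η ≤ ε) {Y : Type*} {l : Filter Y} {f : Y → SAFredholm H} (hf : Tendsto f l (𝓝 T))
    (hE : Tendsto (fun y => (f y).proj ε) l (𝓝 (T.proj ε)))
    (hfin : FiniteDimensional ℂ (T.proj ε).range) :
    ∀ᶠ y in l, ((f y).nonnegDim ε : ℤ) - (f y).nonnegDim η = T.nonnegDim ε - T.nonnegDim η := by
  have hgap := hf.eventually h.eventually_isGap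
  have h1 : Tendsto (fun y => (f y).posProj η ε) l (𝓝 (T.posProj η ε)) :=
    (((continuous_fc (isCc_posCut η ε)).tendsto T).comp hf).mul hE
  have hWfin : FiniteDimensional ℂ (T.posProj η ε).range :=
    Submodule.finiteDimensional_of_le fun x hx => ((h.isGap.mem_range_posProj_iff h.1).mp hx).1
  have h2 := eventually_finrank_range_eq
    (hgap.mono fun y hy => hy.isIdempotentElem_posProj h.1 ε)
    (h.isGap.isIdempotentElem_posProj h.1 ε) hWfin h1
  have h3 := eventually_finrank_range_eq
    (Eventually.of_forall fun y => (f y).isIdempotentElem_proj ε) (T.isIdempotentElem_proj ε) hfin hE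
  filter_upwards [hgap, h2, h3] with y hy1 hy2 hy3
  rw [hy1.nonnegDim_eq h.1 hle hy3.1, h.isGap.nonnegDim_eq h.1 hle hfin, hy2.2]
  push_cast
  ring

theorem nonnegDim_eq_kerDim {S : SAFredholm H} {η : ℝ} (h : (S.proj η).range = S.kerSpace) :
    S.nonnegDim η = S.kerDim := by
  have h1 : S.nonnegSubspace η = S.kerSpace := by
    refine le_antisymm ((S.nonnegSubspace_le η).trans h.le) fun v hv => ?_
    rw [nonnegSubspace_eq]
    exact Submodule.subset_span ⟨h.ge hv, 0, le_rfl, S.mem_kerSpace_iff.mp hv⟩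
  rw [nonnegDim, h1, finrank_kerSpace]

/-- The window `[-η, η]` carries total rank `dim ker T`. If `ker S` has this dimension, it fills the
window, and no eigenvalue has moved away from `0`. -/
theorem Isolating.eventually_nonnegDim_eq {T : SAFredholm H} {η : ℝ} (h : T.Isolating η) :
    ∀ᶠ S in 𝓝 T, S.kerDim = T.kerDim → S.nonnegDim η = T.nonnegDim η := by
  filter_upwards [h.eventually_finrank] with S hS hker
  have := hS.1
  have h1 : S.kerSpace = (S.proj η).range :=
    Submodule.eq_of_le_of_finrank_eq (S.kerSpace_le_range_proj h.1.le)
      (by rw [finrank_kerSpace, hS.2, hker])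
  rw [nonnegDim_eq_kerDim h1.symm, nonnegDim_eq_kerDim h.range_proj_eq, hker]

end SAFredholm

/-! ### Independence of the choices -/

theorem sum_fin_telescope {n : ℕ} (a : Fin (n + 1) → ℤ) :
    ∑ j : Fin n, (a j.succ - a j.castSucc) = a (Fin.last n) - a 0 := by
  induction n with
  | zero => simp
  | succ n ih =>
    rw [Fin.sum_univ_castSucc]
    have := ih fun k => a k.castSucc
    simp only [Fin.succ_castSucc, Fin.succ_last, Fin.castSucc_zero] at this ⊢
    rw [this]
    ring

/-- The expression is `g` at the clamp of `s` to `[a, b]`, minus `g a`. Clamping is continuous into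
`[a, b]`, so local constancy within the interval suffices. -/
theorem eventually_sub_min_eq {g : unitInterval → ℤ} {a b s₀ : unitInterval} (hab : a ≤ b)
    (h : s₀ ∈ Set.Icc a b → ∀ᶠ s in 𝓝[Set.Icc a b] s₀, g s = g s₀) :
    ∀ᶠ s in 𝓝 s₀, g (min s b) - g (min s a) = g (min s₀ b) - g (min s₀ a) := by
  rcases lt_or_ge s₀ a with h1 | h1
  · filter_upwards [Iio_mem_nhds h1] with s hs
    have hs' : s < a := hs
    rw [min_eq_left hs'.le, min_eq_left (hs'.le.trans hab), min_eq_left h1.le,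
      min_eq_left (h1.le.trans hab), sub_self, sub_self]
  rcases lt_or_ge b s₀ with h2 | h2
  · filter_upwards [Ioi_mem_nhds h2] with s hs
    have hs' : b < s := hs
    rw [min_eq_right hs'.le, min_eq_right (hab.trans hs'.le), min_eq_right h2.le,
      min_eq_right (hab.trans h2.le)]
  have hclamp : ∀ s, g (min s b) - g (min s a) = g (max a (min s b)) - g a := by
    intro s
    rcases le_total s a with hs | hs
    · rw [min_eq_left hs, min_eq_left (hs.trans hab), max_eq_left hs, sub_self, sub_self]
    · rw [min_eq_right hs, max_eq_right (le_min hs hab)]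
  have hc0 : max a (min s₀ b) = s₀ := by rw [min_eq_left h2, max_eq_right h1]
  have htend : Tendsto (fun s => max a (min s b)) (𝓝 s₀) (𝓝[Set.Icc a b] s₀) := by
    refine tendsto_nhdsWithin_iff.mpr ⟨?_, Eventually.of_forall fun s =>
      ⟨le_max_left _ _, max_le hab (min_le_right _ _)⟩⟩
    have hc : Continuous fun s : unitInterval => max a (min s b) := by fun_prop
    have := hc.tendsto s₀
    rwa [hc0] at this
  filter_upwards [htend.eventually (h ⟨h1, h2⟩)] with s hs
  rw [hclamp, hclamp, hs, hc0]

namespace FlowPartition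
variable {f : C(unitInterval, SAFredholm H)}

/-- The part of the sum defining the spectral flow that belongs to the interval `[0, s]`. -/
noncomputable def partialFlow (P : FlowPartition f) (s : unitInterval) : ℤ :=
  ∑ j : Fin P.n, (((f (min s (P.t j.succ))).nonnegDim (P.ε j) : ℤ)
    - ((f (min s (P.t j.castSucc))).nonnegDim (P.ε j) : ℤ))

theorem partialFlow_zero (P : FlowPartition f) : P.partialFlow 0 = 0 := by
  refine Finset.sum_eq_zero fun j _ => ?_
  have h : ∀ x : unitInterval, min 0 x = 0 := fun x => min_eq_left unitInterval.nonneg'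
  rw [h, h, sub_self]

theorem partialFlow_one (P : FlowPartition f) : P.partialFlow 1 = P.flow := by
  refine Finset.sum_congr rfl fun j _ => ?_
  have h : ∀ x : unitInterval, min 1 x = x := fun x => min_eq_right unitInterval.le_one'
  rw [h, h]

/-- The quantities `nonnegDim δ` telescope over the partition. Subtracting them term by term leaves
only differences of two windows, which are locally constant on each subinterval. -/
theorem eventually_partialFlow_sub (P : FlowPartition f) {s₀ : unitInterval} {δ : ℝ}
    (hδ : (f s₀).Isolating δ) (hle : ∀ j, δ ≤ P.ε j) :
    ∀ᶠ s in 𝓝 s₀, P.partialFlow s - (f s).nonnegDim δ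
      = P.partialFlow s₀ - (f s₀).nonnegDim δ := by
  have hdecomp : ∀ s, P.partialFlow s - (f s).nonnegDim δ + (f 0).nonnegDim δ
      = ∑ j : Fin P.n, ((((f (min s (P.t j.succ))).nonnegDim (P.ε j) : ℤ)
          - (f (min s (P.t j.succ))).nonnegDim δ)
        - (((f (min s (P.t j.castSucc))).nonnegDim (P.ε j) : ℤ)
          - (f (min s (P.t j.castSucc))).nonnegDim δ)) := by
    intro s
    have h1 := sum_fin_telescope fun k => ((f (min s (P.t k))).nonnegDim δ : ℤ)
    rw [P.t_first, P.t_last, min_eq_left unitInterval.le_one',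
      min_eq_right unitInterval.nonneg'] at h1
    have h2 : P.partialFlow s - (f s).nonnegDim δ + (f 0).nonnegDim δ
        = P.partialFlow s - (((f s).nonnegDim δ : ℤ) - (f 0).nonnegDim δ) := by ring
    rw [h2, ← h1, partialFlow, ← Finset.sum_sub_distrib]
    exact Finset.sum_congr rfl fun j _ => by ring
  have hterm : ∀ j : Fin P.n, ∀ᶠ s in 𝓝 s₀, _ = _ := fun j => eventually_sub_min_eq
    (g := fun s => ((f s).nonnegDim (P.ε j) : ℤ) - (f s).nonnegDim δ) (s₀ := s₀)
    (P.t_strictMono.monotone j.castSucc_lt_succ.le) fun hs =>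
      hδ.eventually_nonnegDim_sub (hle j) ((f.continuous.tendsto s₀).mono_left inf_le_left)
        (P.continuousOn_proj j s₀ hs) (P.finite_rank j s₀ hs)
  filter_upwards [eventually_all.mpr hterm] with s hs
  have h1 := hdecomp s
  rw [Finset.sum_congr rfl fun j _ => hs j, ← hdecomp s₀] at h1
  linarith

theorem exists_pos_le (P : FlowPartition f) : ∃ r > 0, ∀ j, r ≤ P.ε j := by
  have h : ∀ᶠ r in 𝓝[>] (0 : ℝ), ∀ j, r ≤ P.ε j := eventually_all.mpr fun j =>
    mem_of_superset (Ioc_mem_nhdsGT (P.ε_pos j)) fun _ hr => hr.2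
  obtain ⟨r, h1, h2⟩ := (h.and self_mem_nhdsWithin).exists
  exact ⟨r, h2, h1⟩

theorem flow_eq (P Q : FlowPartition f) : P.flow = Q.flow := by
  have hloc : IsLocallyConstant fun s => P.partialFlow s - Q.partialFlow s := by
    rw [IsLocallyConstant.iff_eventually_eq]
    intro s₀
    obtain ⟨r, hr, hrP⟩ := P.exists_pos_le
    obtain ⟨r', hr', hrQ⟩ := Q.exists_pos_le
    -- One `δ` below all the windows of both partitions: the term `nonnegDim δ` then cancels between
    -- `P` and `Q`.
    obtain ⟨δ, hδr, hδ⟩ := (f s₀).exists_isolating (lt_min hr hr')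
    filter_upwards [P.eventually_partialFlow_sub hδ
        fun j => (hδr.trans (min_le_left _ _)).trans (hrP j),
      Q.eventually_partialFlow_sub hδ
        fun j => (hδr.trans (min_le_right _ _)).trans (hrQ j)] with s h1 h2
    linarith
  have h := hloc.apply_eq_of_preconnectedSpace 1 0
  simp only [partialFlow_zero, partialFlow_one, sub_self] at h
  exact sub_eq_zero.mp h

end FlowPartition

/-! ### Grids -/

namespace SAFredholm

/-- The spectral projection `1_{[-ε, ε]}` is of finite rank at `S` and continuous there. -/
def Good (ε : ℝ) (S : SAFredholm H) : Prop :=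
  ContinuousAt (fun S : SAFredholm H => S.proj ε) S ∧ FiniteDimensional ℂ (S.proj ε).range

theorem exists_eventually_good (T : SAFredholm H) : ∃ ε > 0, ∀ᶠ S in 𝓝 T, Good ε S := by
  obtain ⟨η, -, hη⟩ := T.exists_isolating one_pos
  refine ⟨η, hη.1, ?_⟩
  filter_upwards [hη.eventually_continuousAt, hη.eventually_finrank] with S h1 h2
  exact ⟨h1, h2.1⟩

/-- Compare with a smaller isolating window: the difference of the two dimensions is locally
constant, and constancy of the kernel dimension fixes the smaller one. -/
theorem eventually_nonnegDim_eq_of_good {Y : Type*} [TopologicalSpace Y] {g : Y → SAFredholm H}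
    (hg : Continuous g) {ε : ℝ} (hε : 0 < ε) {y₀ : Y} (h : Good ε (g y₀))
    (hker : ∀ y, (g y).kerDim = (g y₀).kerDim) :
    ∀ᶠ y in 𝓝 y₀, (g y).nonnegDim ε = (g y₀).nonnegDim ε := by
  obtain ⟨η, hηε, hη⟩ := (g y₀).exists_isolating hε
  filter_upwards [hη.eventually_nonnegDim_sub hηε (hg.tendsto y₀)
      (h.1.tendsto.comp (hg.tendsto y₀)) h.2,
    (hg.tendsto y₀).eventually hη.eventually_nonnegDim_eq] with y h1 h2
  have := h2 (hker y)
  omega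

theorem eventually_nonnegDim_sub_eq_of_good {Y : Type*} [TopologicalSpace Y]
    {g : Y → SAFredholm H} (hg : Continuous g) {ε ε' : ℝ} (hε : 0 < ε) (hε' : 0 < ε') {y₀ : Y}
    (h : Good ε (g y₀)) (h' : Good ε' (g y₀)) :
    ∀ᶠ y in 𝓝 y₀, ((g y).nonnegDim ε : ℤ) - (g y).nonnegDim ε'
      = (g y₀).nonnegDim ε - (g y₀).nonnegDim ε' := by
  obtain ⟨η, hη1, hη⟩ := (g y₀).exists_isolating (lt_min hε hε')
  filter_upwards [hη.eventually_nonnegDim_sub (hη1.trans (min_le_left _ _)) (hg.tendsto y₀)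
      (h.1.tendsto.comp (hg.tendsto y₀)) h.2,
    hη.eventually_nonnegDim_sub (hη1.trans (min_le_right _ _)) (hg.tendsto y₀)
      (h'.1.tendsto.comp (hg.tendsto y₀)) h'.2] with y h1 h2
  linarith

end SAFredholm

theorem eq_of_eventually_eq_on_Icc {d : unitInterval → ℤ} {a b : unitInterval} (hab : a ≤ b)
    (h : ∀ s ∈ Set.Icc a b, ∀ᶠ s' in 𝓝 s, d s' = d s) : d b = d a := by
  refine isPreconnected_Icc.constant (s := Set.Icc a b) (fun s hs => ?_) (Set.right_mem_Icc.mpr hab)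
    (Set.left_mem_Icc.mpr hab)
  have : Tendsto d (𝓝 s) (𝓝 (d s)) :=
    tendsto_const_nhds.congr' ((h s hs).mono fun _ h => h.symm)
  exact this.mono_left inf_le_left

/-- The points of the uniform partition of the unit interval. -/
noncomputable def gridPoint (N : ℕ) (k : Fin (N + 1)) : unitInterval :=
  ⟨(k : ℝ) / N, by positivity, div_le_one_of_le₀
    (by exact_mod_cast Nat.lt_succ_iff.mp k.2) (by positivity)⟩

theorem gridPoint_zero (N : ℕ) : gridPoint N 0 = 0 := by
  ext; simp [gridPoint]

theorem gridPoint_last {N : ℕ} (hN : 0 < N) : gridPoint N (Fin.last N) = 1 := by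
  ext
  have : (N : ℝ) ≠ 0 := by exact_mod_cast hN.ne'
  simp [gridPoint, this]

theorem gridPoint_strictMono {N : ℕ} (hN : 0 < N) : StrictMono (gridPoint N) := by
  intro i j hij
  have h1 : (0 : ℝ) < N := by exact_mod_cast hN
  have h2 : ((i : ℕ) : ℝ) < ((j : ℕ) : ℝ) := by exact_mod_cast hij
  exact Subtype.mk_lt_mk.mpr (div_lt_div_of_pos_right h2 h1)

theorem dist_gridPoint_le {N : ℕ} {i : Fin N} {s : unitInterval}
    (hs : s ∈ Set.Icc (gridPoint N i.castSucc) (gridPoint N i.succ)) :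
    dist s (gridPoint N i.castSucc) ≤ 1 / N := by
  have h1 : ((i : ℕ) : ℝ) / N ≤ (s : ℝ) := hs.1
  have h2 : (s : ℝ) ≤ (((i : ℕ) + 1 : ℕ) : ℝ) / N := hs.2
  have h3 : dist s (gridPoint N i.castSucc) = |(s : ℝ) - ((i : ℕ) : ℝ) / N| := rfl
  rw [h3, abs_of_nonneg (by linarith)]
  push_cast at h2
  rw [add_div] at h2
  linarith

theorem exists_good_grid (F : C(unitInterval × unitInterval, SAFredholm H)) :
    ∃ N : ℕ, 0 < N ∧ ∃ e : Fin N → Fin N → ℝ, ∀ i j, 0 < e i j ∧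
      ∀ s ∈ Set.Icc (gridPoint N i.castSucc) (gridPoint N i.succ),
      ∀ t ∈ Set.Icc (gridPoint N j.castSucc) (gridPoint N j.succ),
        SAFredholm.Good (e i j) (F (s, t)) := by
  -- Requiring the property on a neighbourhood makes each set open. Positivity is part of the
  -- condition because the cover is indexed by all real `ε`.
  let c : ℝ → Set (unitInterval × unitInterval) := fun ε =>
    {p | ∀ᶠ q in 𝓝 p, 0 < ε ∧ SAFredholm.Good ε (F q)}
  have hc : ∀ ε, IsOpen (c ε) := fun ε => isOpen_setOfPred_eventually_nhds
  have hcover : (Set.univ : Set (unitInterval × unitInterval)) ⊆ ⋃ ε, c ε := by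
    intro p _
    obtain ⟨ε, hε, h⟩ := (F p).exists_eventually_good
    exact Set.mem_iUnion.mpr ⟨ε, ((F.continuous.tendsto p).eventually h).mono fun q hq => ⟨hε, hq⟩⟩
  obtain ⟨δ, hδ, hball⟩ := lebesgue_number_lemma_of_metric isCompact_univ hc hcover
  obtain ⟨n, hn⟩ := exists_nat_one_div_lt hδ
  choose e he using fun i j : Fin (n + 1) =>
    hball (gridPoint (n + 1) i.castSucc, gridPoint (n + 1) j.castSucc) (Set.mem_univ _)
  have hn' : (1 : ℝ) / ((n + 1 : ℕ) : ℝ) < δ := by exact_mod_cast hn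
  refine ⟨n + 1, n.succ_pos, e, fun i j => ⟨?_, fun s hs t ht => ?_⟩⟩
  · exact (he i j (Metric.mem_ball_self hδ)).self_of_nhds.1
  · have hmem : (s, t) ∈ Metric.ball
        (gridPoint (n + 1) i.castSucc, gridPoint (n + 1) j.castSucc) δ :=
      max_lt ((dist_gridPoint_le hs).trans_lt hn') ((dist_gridPoint_le ht).trans_lt hn')
    exact (he i j hmem).self_of_nhds.2

/-- The choices for the definition of the spectral flow given by a uniform partition. -/
noncomputable def FlowPartition.ofGrid (f : C(unitInterval, SAFredholm H)) {N : ℕ} (hN : 0 < N)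
    (e : Fin N → ℝ) (he : ∀ j, 0 < e j)
    (hgood : ∀ j, ∀ t ∈ Set.Icc (gridPoint N j.castSucc) (gridPoint N j.succ),
      SAFredholm.Good (e j) (f t)) : FlowPartition f where
  n := N
  t := gridPoint N
  t_strictMono := gridPoint_strictMono hN
  t_first := gridPoint_zero N
  t_last := gridPoint_last hN
  ε := e
  ε_pos := he
  continuousOn_proj := fun j t ht =>
    (ContinuousAt.comp (f := f) (hgood j t ht).1 f.continuous.continuousAt).continuousWithinAt
  finite_rank := fun j t ht => (hgood j t ht).2

/-- The two-dimensional grid of the constant homotopy is used along a single row. -/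
theorem nonempty_flowPartition (f : C(unitInterval, SAFredholm H)) :
    Nonempty (FlowPartition f) := by
  obtain ⟨N, hN, e, he⟩ := exists_good_grid (f.comp ContinuousMap.snd)
  let i : Fin N := ⟨0, hN⟩
  have hi : gridPoint N i.castSucc ∈ Set.Icc (gridPoint N i.castSucc) (gridPoint N i.succ) :=
    Set.left_mem_Icc.mpr ((gridPoint_strictMono hN).monotone i.castSucc_lt_succ.le)
  exact ⟨FlowPartition.ofGrid f hN (e i) (fun j => (he i j).1)
    fun j t ht => (he i j).2 _ hi t ht⟩

theorem FlowPartition.flow_eq_spectralFlow {f : C(unitInterval, SAFredholm H)}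
    (P : FlowPartition f) : P.flow = spectralFlow f := by
  unfold spectralFlow
  rw [dif_pos ⟨P⟩]
  exact P.flow_eq _

/-! ### Homotopy invariance -/

theorem sum_sub_eq_zero_of_chain {N : ℕ} (hN : 0 < N) (u v : Fin N → ℤ)
    (hu : u ⟨0, hN⟩ = 0) (hv : v ⟨N - 1, by omega⟩ = 0)
    (huv : ∀ i j : Fin N, (j : ℕ) = i + 1 → v i = u j) : ∑ j, (v j - u j) = 0 := by
  -- The value `0` at the extra last index agrees with `hv`, so that `v j` is `w` at `j + 1` for
  -- every `j`, including the last.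
  let w : Fin (N + 1) → ℤ := fun k => if h : (k : ℕ) < N then u ⟨k, h⟩ else 0
  have h1 : ∀ j : Fin N, u j = w j.castSucc := fun j => by simp [w]
  have h2 : ∀ j : Fin N, v j = w j.succ := fun j => by
    by_cases h : (j : ℕ) + 1 < N
    · simp only [w, Fin.val_succ, h, dif_pos]
      exact huv j _ rfl
    · have : j = ⟨N - 1, by omega⟩ := Fin.ext (by have := j.2; simp only; omega)
      simp only [w, Fin.val_succ, h, dif_neg, not_false_eq_true]
      rw [this, hv]
  simp_rw [h1, h2, sum_fin_telescope]
  have h3 : w 0 = 0 := by simp [w, hN, hu]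
  have h4 : w (Fin.last N) = 0 := by simp [w]
  rw [h3, h4, sub_self]

theorem spectralFlow_eq_of_homotopy {f₁ f₂ : C(unitInterval, SAFredholm H)}
    (F : ContinuousMap.Homotopy f₁ f₂)
    (h0 : ∀ s s' : unitInterval, (F (s, 0)).kerDim = (F (s', 0)).kerDim)
    (h1 : ∀ s s' : unitInterval, (F (s, 1)).kerDim = (F (s', 1)).kerDim) :
    spectralFlow f₁ = spectralFlow f₂ := by
  obtain ⟨N, hN, e, he⟩ := exists_good_grid F.toContinuousMap
  let row : unitInterval → C(unitInterval, SAFredholm H) := F.toContinuousMap.curry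
  have hcol : ∀ t, Continuous fun s => F (s, t) := fun t => by fun_prop
  have hmono := (gridPoint_strictMono hN).monotone
  have hstep : ∀ i : Fin N, spectralFlow (row (gridPoint N i.castSucc))
      = spectralFlow (row (gridPoint N i.succ)) := by
    intro i
    set a := gridPoint N i.castSucc with ha
    set b := gridPoint N i.succ with hb
    have hab : a ≤ b := hmono i.castSucc_lt_succ.le
    have hj : ∀ j : Fin N, gridPoint N j.castSucc ≤ gridPoint N j.succ :=
      fun j => hmono j.castSucc_lt_succ.le
    rw [← (FlowPartition.ofGrid (row a) hN (e i) (fun j => (he i j).1)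
        fun j t ht => (he i j).2 a (Set.left_mem_Icc.mpr hab) t ht).flow_eq_spectralFlow,
      ← (FlowPartition.ofGrid (row b) hN (e i) (fun j => (he i j).1)
        fun j t ht => (he i j).2 b (Set.right_mem_Icc.mpr hab) t ht).flow_eq_spectralFlow]
    -- Exchanging the order of differences: the change of the flow across the strip is the sum of
    -- increments in `t` of the changes in `s`.
    let V : Fin N → unitInterval → ℤ := fun j t =>
      ((F (b, t)).nonnegDim (e i j) : ℤ) - (F (a, t)).nonnegDim (e i j)
    have hV : ∑ j : Fin N, (V j (gridPoint N j.succ) - V j (gridPoint N j.castSucc)) = 0 := by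
      refine sum_sub_eq_zero_of_chain hN _ _ ?_ ?_ ?_
      · have ht : gridPoint N (Fin.castSucc ⟨0, hN⟩) = 0 := gridPoint_zero N
        refine sub_eq_zero.mpr ?_
        refine eq_of_eventually_eq_on_Icc (d := fun s => ((F (s, _)).nonnegDim _ : ℤ)) hab
          fun s hs => ?_
        rw [ht]
        have hg := (he i ⟨0, hN⟩).2 s hs 0 ⟨ht.le, unitInterval.nonneg'⟩
        filter_upwards [SAFredholm.eventually_nonnegDim_eq_of_good (hcol 0) (he i _).1 hg
          fun s' => h0 s' s] with s' hs'
        exact congrArg _ hs'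
      · have ht : gridPoint N (Fin.succ ⟨N - 1, by omega⟩) = 1 := by
          rw [← gridPoint_last hN]
          congr 1
          exact Fin.ext (by simp only [Fin.val_succ, Fin.val_last]; omega)
        refine sub_eq_zero.mpr ?_
        refine eq_of_eventually_eq_on_Icc (d := fun s => ((F (s, _)).nonnegDim _ : ℤ)) hab
          fun s hs => ?_
        rw [ht]
        have hg := (he i ⟨N - 1, by omega⟩).2 s hs 1 ⟨unitInterval.le_one', ht.ge⟩
        filter_upwards [SAFredholm.eventually_nonnegDim_eq_of_good (hcol 1) (he i _).1 hg
          fun s' => h1 s' s] with s' hs'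
        exact congrArg _ hs'
      -- At a shared node both windows are admissible along the whole side from `a` to `b`, so their
      -- dimensions differ by a constant there and the changes from `a` to `b` agree.
      · intro j k hjk
        have ht : gridPoint N k.castSucc = gridPoint N j.succ := by
          congr 1
          exact Fin.ext hjk
        rw [ht]
        set t := gridPoint N j.succ
        have hd := eq_of_eventually_eq_on_Icc
          (d := fun s => ((F (s, t)).nonnegDim (e i j) : ℤ) - (F (s, t)).nonnegDim (e i k)) hab
          fun s hs => SAFredholm.eventually_nonnegDim_sub_eq_of_good (hcol t) (he i j).1 (he i k).1
            ((he i j).2 s hs t (Set.right_mem_Icc.mpr (hj j)))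
            ((he i k).2 s hs t (ht ▸ Set.left_mem_Icc.mpr (hj k)))
        simp only [V]
        linarith
    have hdiff : ∑ j : Fin N, (V j (gridPoint N j.succ) - V j (gridPoint N j.castSucc))
        = ∑ j : Fin N, (((F (b, gridPoint N j.succ)).nonnegDim (e i j) : ℤ)
            - (F (b, gridPoint N j.castSucc)).nonnegDim (e i j))
          - ∑ j : Fin N, (((F (a, gridPoint N j.succ)).nonnegDim (e i j) : ℤ)
            - (F (a, gridPoint N j.castSucc)).nonnegDim (e i j)) := by
      rw [← Finset.sum_sub_distrib]
      exact Finset.sum_congr rfl fun j _ => by simp only [V]; ring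
    rw [hV] at hdiff
    exact (sub_eq_zero.mp hdiff.symm).symm
  have hall : ∀ k : Fin (N + 1),
      spectralFlow (row (gridPoint N 0)) = spectralFlow (row (gridPoint N k)) := by
    intro k
    induction k using Fin.induction with
    | zero => rfl
    | succ i ih => exact ih.trans (hstep i)
  have h := hall (Fin.last N)
  rw [gridPoint_zero, gridPoint_last hN] at h
  have e0 : row 0 = f₁ := by ext1 t; exact F.apply_zero t
  have e1 : row 1 = f₂ := by ext1 t; exact F.apply_one t
  rwa [e0, e1] at h

end GapSpectralFlow

/-! ### The theorem -/

theorem propositionp {H : Type*} [NormedAddCommGroup H] [InnerProductSpace ℂ H] [CompleteSpace H]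
    [TopologicalSpace.SeparableSpace H] :
    (∀ f : C(unitInterval, GapSpectralFlow.SAFredholm H),
      Nonempty (GapSpectralFlow.FlowPartition f) ∧
      ∀ P : GapSpectralFlow.FlowPartition f, P.flow = GapSpectralFlow.spectralFlow f) ∧
    (∀ (f₁ f₂ : C(unitInterval, GapSpectralFlow.SAFredholm H))
      (F : ContinuousMap.Homotopy f₁ f₂),
      (∀ s s' : unitInterval, (F (s, 0)).kerDim = (F (s', 0)).kerDim) →
      (∀ s s' : unitInterval, (F (s, 1)).kerDim = (F (s', 1)).kerDim) →
      GapSpectralFlow.spectralFlow f₁ = GapSpectralFlow.spectralFlow f₂) ∧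
    (∀ f₁ f₂ : C(unitInterval, GapSpectralFlow.SAFredholm H),
      ContinuousMap.HomotopicRel f₁ f₂ {0, 1} →
      GapSpectralFlow.spectralFlow f₁ = GapSpectralFlow.spectralFlow f₂) := by
  refine ⟨fun f => ⟨GapSpectralFlow.nonempty_flowPartition f, fun P => P.flow_eq_spectralFlow⟩,
    fun f₁ f₂ F h0 h1 => GapSpectralFlow.spectralFlow_eq_of_homotopy F h0 h1, ?_⟩
  -- With fixed endpoints, the operators at `t = 0` and `t = 1` do not change with `s`, and neither
  -- do their kernels.
  rintro f₁ f₂ ⟨F⟩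
  refine GapSpectralFlow.spectralFlow_eq_of_homotopy F.toHomotopy (fun s s' => ?_) fun s s' => ?_
  · exact congrArg _ ((F.eq_fst s (by simp)).trans (F.eq_fst s' (by simp)).symm)
  · exact congrArg _ ((F.eq_fst s (by simp)).trans (F.eq_fst s' (by simp)).symm)
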